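/- For an integer $n\ge 6$, let $H_{2n}$ be the simple graph with vertex set $\{u_1,\dots,u_n\}\cup\{v_1,\dots,v_n\}$ whose edges are $u_iv_i$ for $1\le i\le n$ with $i\ne 3$ and $i\neq n-2$; $u_iv_{i+1}$ and $u_{i+1}v_i$ for $1\le i\le n-1$; and the four edges $u_1v_3,\ u_3v_1,\ u_{n-2}v_n,\ u_nv_{n-2}$. The spectral gap of a finite simple graph on at least two vertices is the difference between the two largest eigenvalues (counted with multiplicity) of its adjacency matrix. **Theorem.** Let $n\ge 6$. Then $H_{2n}$ is a connected cubic (that is, $3$-regular) bipartite graph on $2n$ vertices, and among all connected cubic bipartite graphs on $2n$ vertices it is, up to isomorphism, the unique graph with minimum spectral gap: every connected cubic bipartite graph $G$ on $2n$ vertices has spectral gap at least that of $H_{2n}$, with equality if and only if $G$ is isomorphic to $H_{2n}$. -/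

import Mathlib

/-- The incidence rule of `H_{2n}` between the two sides `u_1, …, u_n` and `v_1, …, v_n` of its
bipartition: `H2nRel n i j` says that `u_i ∼ v_j` (labels run from `1` to `n`).  The pairs are
`u_i v_i` for `i ≠ 3, n - 2`, the pairs `u_i v_{i+1}` and `u_{i+1} v_i`, and the four extra pairs
`u_1 v_3`, `u_3 v_1`, `u_{n-2} v_n`, `u_n v_{n-2}`. -/
def H2nRel (n i j : ℕ) : Prop :=
  (i = j ∧ i ≠ 3 ∧ i + 2 ≠ n) ∨ j = i + 1 ∨ i = j + 1 ∨
    (i = 1 ∧ j = 3) ∨ (i = 3 ∧ j = 1) ∨ (i + 2 = n ∧ j = n) ∨ (i = n ∧ j + 2 = n)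

instance (n i j : ℕ) : Decidable (H2nRel n i j) := by
  unfold H2nRel; infer_instance

/-- The graph `H_{2n}`: `Sum.inl i` is the vertex `u_{i+1}` and `Sum.inr j` is `v_{j+1}`,
where `i, j : Fin n` are counted from `0`. -/
def H2n (n : ℕ) : SimpleGraph (Fin n ⊕ Fin n) where
  Adj
    | Sum.inl i, Sum.inr j => H2nRel n (i + 1) (j + 1)
    | Sum.inr j, Sum.inl i => H2nRel n (i + 1) (j + 1)
    | _, _ => False
  symm := ⟨by rintro (i | i) (j | j) h <;> exact h⟩
  loopless := ⟨by rintro (i | i) h <;> exact h⟩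

instance (n : ℕ) : DecidableRel (H2n n).Adj
  | Sum.inl i, Sum.inr j => inferInstanceAs (Decidable (H2nRel n (i + 1) (j + 1)))
  | Sum.inr j, Sum.inl i => inferInstanceAs (Decidable (H2nRel n (i + 1) (j + 1)))
  | Sum.inl _, Sum.inl _ => inferInstanceAs (Decidable False)
  | Sum.inr _, Sum.inr _ => inferInstanceAs (Decidable False)

/-- The spectral gap of a finite graph on at least two vertices: the difference of the two largest
eigenvalues, counted with multiplicity, of the real adjacency matrix.  (`eigenvalues₀` lists the
eigenvalues of a Hermitian matrix in decreasing order, with multiplicity.)  It is set to `0` on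
graphs with fewer than two vertices. -/
noncomputable def spectralGap {V : Type*} [Fintype V] [DecidableEq V] (G : SimpleGraph V)
    [DecidableRel G.Adj] : ℝ :=
  if h : 2 ≤ Fintype.card V then
    (G.isHermitian_adjMatrix (R := ℝ)).eigenvalues₀ ⟨0, by omega⟩ -
      (G.isHermitian_adjMatrix (R := ℝ)).eigenvalues₀ ⟨1, by omega⟩
  else 0

/-! For a connected cubic graph the spectral gap is the minimum of the Dirichlet energy over unit
vectors of mean zero, attained exactly at eigenfunctions (`spectralGap_variational`). Hence two gaps
can be compared by turning a minimiser on `G` into a test function on `H_{2n}`.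

List the vertices of `G` in increasing order of a minimiser, with values `x` and increments `d k = x
(k + 1) - x k ≥ 0`. An edge spans a run of consecutive increments, so the energy is a quadratic form
in the `d k` whose coefficients count the edges over two given increments
(`orderedEnergy_eq_sum_crossing`). Nothing in it is negative, so terms may be dropped and
coefficients replaced by lower bounds. Bipartiteness and connectedness force every proper initial
segment to send out at least 2 edges if its size is even and at least 3 if it is odd; the first four
vertices send out at least 4, and so do the last four. `H_{2n}` attains these bounds at the
boundaries between its blocks: four vertices, then pairs, then four vertices.

Averaging `x` over these blocks gives a function `y` of mean zero on `H_{2n}`, and the cut bounds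
yield `E_H(y) + 3/5 (|x|² - |y|²) ≤ E_G(x)` (`energy_blockAverage_le`). The gap `μ` of `H_{2n}` is
at most `1/2 < 3/5`. If `|x| = 1` and the gap of `G` is at most `μ`, then `μ |y|² + 3/5 (1 - |y|²) ≤
μ` forces `|y| = 1`. So the gaps agree, `x` is constant on blocks and `y` is an eigenfunction of
`H_{2n}`.

Such a `y` increases strictly from block to block (`columnFun_strictMono`), so equality of energies
makes every block cut minimal and excludes edges between non-consecutive blocks
(`crossing_eq_of_energy_le`). These cut sizes determine the graph (`OrderedCubic.exists_columns`).
-/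

/-! ### Spectral gap and Dirichlet energy -/

open Matrix in
/-- An orthonormal eigenbasis of the adjacency matrix, with the spectral gap read off it. -/
theorem exists_eigenbasis_spectralGap {V : Type*} [Fintype V] [DecidableEq V] (G : SimpleGraph V)
    [DecidableRel G.Adj] (hc : 2 ≤ Fintype.card V) :
    ∃ (b : V → V → ℝ) (l : V → ℝ) (i₀ i₁ : V), i₀ ≠ i₁ ∧ spectralGap G = l i₀ - l i₁ ∧
      (∀ i, l i ≤ l i₀) ∧ (∀ i, i ≠ i₀ → l i ≤ l i₁) ∧
      (∀ i, G.adjMatrix ℝ *ᵥ b i = l i • b i) ∧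
      (∀ i j, b i ⬝ᵥ b j = if i = j then 1 else 0) ∧
      ∀ x y : V → ℝ, ∑ i, (b i ⬝ᵥ x) * (b i ⬝ᵥ y) = x ⬝ᵥ y := by
  set hA := G.isHermitian_adjMatrix (R := ℝ)
  set σ : Fin (Fintype.card V) ≃ V := Fintype.equivOfCardEq (Fintype.card_fin _)
  have hl : ∀ i, hA.eigenvalues i = hA.eigenvalues₀ (σ.symm i) := fun i => rfl
  refine ⟨fun i => hA.eigenvectorBasis i, hA.eigenvalues, σ ⟨0, by omega⟩, σ ⟨1, by omega⟩,
    ?_, ?_, ?_, ?_, ?_, ?_, ?_⟩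
  · simp
  · rw [hl, hl, spectralGap, dif_pos hc]; simp
  · intro i
    rw [hl, hl, Equiv.symm_apply_apply]
    exact hA.eigenvalues₀_antitone (Fin.mk_le_of_le_val (Nat.zero_le _))
  · intro i hi
    rw [hl, hl, Equiv.symm_apply_apply]
    refine hA.eigenvalues₀_antitone (Fin.mk_le_of_le_val ?_)
    rw [Nat.one_le_iff_ne_zero]
    intro h
    apply hi
    rw [← Equiv.symm_apply_eq]
    exact Fin.ext h
  · exact fun i => hA.mulVec_eigenvectorBasis i
  · intro i j
    have := orthonormal_iff_ite.1 hA.eigenvectorBasis.orthonormal j i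
    rw [EuclideanSpace.inner_eq_star_dotProduct] at this
    simpa [eq_comm] using this
  · intro x y
    have := hA.eigenvectorBasis.sum_inner_mul_inner (WithLp.toLp 2 x) (WithLp.toLp 2 y)
    simp only [EuclideanSpace.inner_eq_star_dotProduct, star_trivial] at this
    rw [dotProduct_comm x y, ← this]
    refine Finset.sum_congr rfl fun i _ => ?_
    rw [dotProduct_comm y]

/-- The Dirichlet energy of a function on the vertices of a graph. -/
noncomputable def dirichletEnergy {V : Type*} [Fintype V] (G : SimpleGraph V) [DecidableRel G.Adj]
    (x : V → ℝ) : ℝ :=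
  (∑ i, ∑ j, if G.Adj i j then (x i - x j) ^ 2 else 0) / 2

section
open Matrix
variable {V : Type*} [Fintype V] {G : SimpleGraph V} [DecidableRel G.Adj] {d : ℕ}

theorem dirichletEnergy_nonneg (x : V → ℝ) : 0 ≤ dirichletEnergy G x := by
  unfold dirichletEnergy
  have : ∀ i j, 0 ≤ if G.Adj i j then (x i - x j) ^ 2 else 0 := by
    intro i j; split_ifs <;> positivity
  exact div_nonneg (Finset.sum_nonneg fun i _ => Finset.sum_nonneg fun j _ => this i j) (by norm_num)

theorem adjMatrix_mulVec_one (hd : G.IsRegularOfDegree d) :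
    G.adjMatrix ℝ *ᵥ (fun _ => (1 : ℝ)) = (d : ℝ) • (fun _ => (1 : ℝ)) := by
  ext v
  have := hd v
  simp [SimpleGraph.adjMatrix_mulVec_apply, this]

variable [DecidableEq V]

theorem eq_of_dirichletEnergy_eq_zero (hG : G.Connected) {x : V → ℝ}
    (h : dirichletEnergy G x = 0) (u v : V) : x u = x v := by
  have h' : Matrix.toLinearMap₂' ℝ (G.lapMatrix ℝ) x x = 0 := by
    rw [SimpleGraph.lapMatrix_toLinearMap₂']; exact h
  exact (SimpleGraph.lapMatrix_toLinearMap₂'_apply'_eq_zero_iff_forall_reachable G x).1 h' u v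
    (hG.preconnected u v)

theorem dirichletEnergy_eq (hd : G.IsRegularOfDegree d) (x : V → ℝ) :
    dirichletEnergy G x = d * (x ⬝ᵥ x) - x ⬝ᵥ (G.adjMatrix ℝ *ᵥ x) := by
  have h : dirichletEnergy G x = Matrix.toLinearMap₂' ℝ (G.lapMatrix ℝ) x x := by
    rw [SimpleGraph.lapMatrix_toLinearMap₂']; rfl
  rw [h, Matrix.toLinearMap₂'_apply', SimpleGraph.lapMatrix, Matrix.sub_mulVec,
    dotProduct_sub]
  congr 1
  rw [SimpleGraph.dotProduct_mulVec_degMatrix, dotProduct, Finset.mul_sum]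
  refine Finset.sum_congr rfl fun i _ => ?_
  rw [hd i]; ring

/-- The spectral gap of a connected regular graph is attained, as a Rayleigh quotient of the
Dirichlet energy, on the functions with mean zero, exactly at the eigenfunctions. -/
theorem spectralGap_variational (hG : G.Connected) (hd : G.IsRegularOfDegree d)
    (hc : 2 ≤ Fintype.card V) :
    (∃ x : V → ℝ, ∑ v, x v = 0 ∧ ∑ v, x v ^ 2 = 1 ∧ dirichletEnergy G x = spectralGap G) ∧
    ∀ x : V → ℝ, ∑ v, x v = 0 → spectralGap G * ∑ v, x v ^ 2 ≤ dirichletEnergy G x ∧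
      (dirichletEnergy G x = spectralGap G * ∑ v, x v ^ 2 →
        G.adjMatrix ℝ *ᵥ x = (d - spectralGap G) • x) := by
  obtain ⟨b, l, i₀, i₁, hi, hgap, hl0, hl1, hb, ho, hs⟩ := exists_eigenbasis_spectralGap G hc
  have hsq : ∀ x : V → ℝ, ∑ v, x v ^ 2 = x ⬝ᵥ x := fun x =>
    Finset.sum_congr rfl fun i _ => by ring
  have hone : ∀ x : V → ℝ, ∑ v, x v = x ⬝ᵥ (fun _ => (1 : ℝ)) := fun x => by simp [dotProduct]
  have hbA : ∀ i x, b i ⬝ᵥ (G.adjMatrix ℝ *ᵥ x) = l i * (b i ⬝ᵥ x) := by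
    intro i x
    rw [dotProduct_mulVec, ← mulVec_transpose, (G.isSymm_adjMatrix).eq, hb, smul_dotProduct,
      smul_eq_mul]
  have hE : ∀ x, dirichletEnergy G x = ∑ i, (d - l i) * (b i ⬝ᵥ x) ^ 2 := by
    intro x
    rw [dirichletEnergy_eq hd, ← hs x (G.adjMatrix ℝ *ᵥ x), ← hs x x, Finset.mul_sum,
      ← Finset.sum_sub_distrib]
    refine Finset.sum_congr rfl fun i _ => ?_
    rw [hbA]; ring
  have hEb : ∀ i, dirichletEnergy G (b i) = d - l i := by
    intro i
    rw [dirichletEnergy_eq hd, hbA, ho, if_pos rfl]; ring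
  have hld : ∀ i, l i ≤ d := fun i => by
    have := dirichletEnergy_nonneg (G := G) (b i)
    rw [hEb] at this; linarith
  -- The constant function has eigenvalue `d`, and some basis vector is not orthogonal to it; that
  -- vector must have the same eigenvalue.
  have hl0d : l i₀ = d := by
    have h1 : ∑ i, (b i ⬝ᵥ fun _ => (1 : ℝ)) * (b i ⬝ᵥ fun _ => (1 : ℝ)) ≠ 0 := by
      rw [hs, dotProduct]
      simp only [mul_one, Finset.sum_const, Finset.card_univ, nsmul_eq_mul]
      exact_mod_cast (by omega)
    obtain ⟨i, -, h2⟩ := Finset.exists_ne_zero_of_sum_ne_zero h1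
    have h3 := hbA i (fun _ => 1)
    rw [adjMatrix_mulVec_one hd, dotProduct_smul, smul_eq_mul] at h3
    have h4 := mul_right_cancel₀ (left_ne_zero_of_mul h2) h3
    exact le_antisymm (hld _) (h4 ▸ hl0 i)
  -- The top eigenvector has energy zero, hence is constant by connectedness; orthogonality to it
  -- means mean zero.
  have hc0 : ∀ u v, b i₀ u = b i₀ v :=
    eq_of_dirichletEnergy_eq_zero hG (by rw [hEb, hl0d, sub_self])
  have hb0 : b i₀ = (b i₀ i₀) • (fun _ => (1 : ℝ)) := by
    ext v; simp [hc0 v i₀]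
  have hb0' : ∀ x : V → ℝ, b i₀ ⬝ᵥ x = b i₀ i₀ * ∑ v, x v := by
    intro x
    rw [hb0, smul_dotProduct, hone x, dotProduct_comm, smul_eq_mul]; simp
  have hne : b i₀ i₀ ≠ 0 := by
    intro h
    have := ho i₀ i₀
    rw [hb0', h] at this
    simp at this
  refine ⟨⟨b i₁, ?_, ?_, ?_⟩, fun x hx => ?_⟩
  · have := ho i₀ i₁
    rw [hb0', if_neg hi] at this
    exact (mul_eq_zero.1 this).resolve_left hne
  · rw [hsq, ho, if_pos rfl]
  · rw [hEb, hgap, hl0d]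
  · have hx0 : b i₀ ⬝ᵥ x = 0 := by rw [hb0', hx, mul_zero]
    have hnn : ∀ i ∈ Finset.univ, 0 ≤ (l i₁ - l i) * (b i ⬝ᵥ x) ^ 2 := by
      intro i _
      by_cases h : i = i₀
      · rw [h, hx0]; simp
      · exact mul_nonneg (sub_nonneg.2 (hl1 i h)) (sq_nonneg _)
    have hdiff : dirichletEnergy G x - spectralGap G * ∑ v, x v ^ 2
        = ∑ i, (l i₁ - l i) * (b i ⬝ᵥ x) ^ 2 := by
      rw [hE, hsq, ← hs x x, Finset.mul_sum, ← Finset.sum_sub_distrib]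
      refine Finset.sum_congr rfl fun i _ => ?_
      rw [hgap, hl0d]; ring
    refine ⟨?_, fun he => ?_⟩
    · have := Finset.sum_nonneg hnn
      linarith
    -- Equality kills every term, so `x` only has components along eigenvectors with eigenvalue `l
    -- i₁`.
    · rw [he, sub_self, eq_comm, Finset.sum_eq_zero_iff_of_nonneg hnn] at hdiff
      have hz : ∀ i, b i ⬝ᵥ (G.adjMatrix ℝ *ᵥ x - (d - spectralGap G) • x) = 0 := by
        intro i
        rw [dotProduct_sub, hbA, dotProduct_smul, smul_eq_mul, hgap, hl0d]
        rcases mul_eq_zero.1 (hdiff i (Finset.mem_univ i)) with h | h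
        · rw [show l i = l i₁ by linarith]; ring
        · rw [pow_eq_zero_iff two_ne_zero] at h
          rw [h]; ring
      rw [← sub_eq_zero, ← dotProduct_self_eq_zero, ← hs]
      simp [hz]

end

/-! ### Basic properties of `H_{2n}` -/

theorem H2n_adj_inl_inr {n : ℕ} (i j : Fin n) :
    (H2n n).Adj (Sum.inl i) (Sum.inr j) ↔ H2nRel n (i + 1) (j + 1) := Iff.rfl

theorem H2n_adj_inr_inl {n : ℕ} (i j : Fin n) :
    (H2n n).Adj (Sum.inr j) (Sum.inl i) ↔ H2nRel n (i + 1) (j + 1) := Iff.rfl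

theorem H2n_not_adj_inl {n : ℕ} (i j : Fin n) : ¬ (H2n n).Adj (Sum.inl i) (Sum.inl j) := id

theorem H2n_not_adj_inr {n : ℕ} (i j : Fin n) : ¬ (H2n n).Adj (Sum.inr i) (Sum.inr j) := id

theorem H2nRel_comm {n i j : ℕ} : H2nRel n i j ↔ H2nRel n j i := by
  unfold H2nRel; omega

theorem H2n_isBipartite (n : ℕ) : (H2n n).IsBipartite := by
  refine ⟨SimpleGraph.Coloring.mk (fun v => Sum.elim (fun _ => 0) (fun _ => 1) v) ?_⟩
  rintro (i | i) (j | j) h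
  · exact (H2n_not_adj_inl i j h).elim
  · simp
  · simp
  · exact (H2n_not_adj_inr i j h).elim

theorem H2n_connected {n : ℕ} (hn : 6 ≤ n) : (H2n n).Connected := by
  have h0 : 0 < n := by omega
  have key : ∀ k (hk : k < n), (H2n n).Reachable (Sum.inl ⟨0, h0⟩) (Sum.inl ⟨k, hk⟩) ∧
      (H2n n).Reachable (Sum.inl ⟨0, h0⟩) (Sum.inr ⟨k, hk⟩) := by
    intro k
    induction k with
    | zero =>
      intro hk
      refine ⟨SimpleGraph.Reachable.refl _, SimpleGraph.Adj.reachable ?_⟩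
      rw [H2n_adj_inl_inr]; exact Or.inl ⟨rfl, by dsimp only; omega, by dsimp only; omega⟩
    | succ k ih =>
      intro hk
      obtain ⟨h1, h2⟩ := ih (by omega)
      refine ⟨h2.trans (SimpleGraph.Adj.reachable ?_), h1.trans (SimpleGraph.Adj.reachable ?_)⟩
      · rw [H2n_adj_inr_inl]; exact Or.inr (Or.inr (Or.inl rfl))
      · rw [H2n_adj_inl_inr]; exact Or.inr (Or.inl rfl)
  have h : ∀ v, (H2n n).Reachable (Sum.inl ⟨0, h0⟩) v := by
    rintro (⟨k, hk⟩ | ⟨k, hk⟩)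
    exacts [(key k hk).1, (key k hk).2]
  have : Nonempty (Fin n ⊕ Fin n) := ⟨Sum.inl ⟨0, h0⟩⟩
  exact ⟨fun u v => (h u).symm.trans (h v)⟩

theorem card_filter_H2nRel {n : ℕ} (hn : 6 ≤ n) (i : Fin n) :
    (Finset.univ.filter fun j : Fin n => H2nRel n (i + 1) (j + 1)).card = 3 := by
  have key : ∃ a b c : Fin n, a ≠ b ∧ a ≠ c ∧ b ≠ c ∧
      ∀ j : Fin n, H2nRel n (i + 1) (j + 1) ↔ j = a ∨ j = b ∨ j = c := by
    have hi := i.2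
    simp only [Fin.ext_iff, ne_eq, H2nRel]
    by_cases h1 : i.1 ≤ 1
    · exact ⟨⟨0, by omega⟩, ⟨1, by omega⟩, ⟨2, by omega⟩, by simp, by simp, by simp,
        fun j => by have := j.2; dsimp only; omega⟩
    by_cases h2 : i.1 = 2
    · exact ⟨⟨0, by omega⟩, ⟨1, by omega⟩, ⟨3, by omega⟩, by simp, by simp, by simp,
        fun j => by have := j.2; dsimp only; omega⟩
    by_cases h3 : n ≤ i.1 + 2
    · exact ⟨⟨n - 3, by omega⟩, ⟨n - 2, by omega⟩, ⟨n - 1, by omega⟩, by dsimp only; omega,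
        by dsimp only; omega, by dsimp only; omega, fun j => by have := j.2; dsimp only; omega⟩
    by_cases h4 : n = i.1 + 3
    · exact ⟨⟨n - 4, by omega⟩, ⟨n - 2, by omega⟩, ⟨n - 1, by omega⟩, by dsimp only; omega,
        by dsimp only; omega, by dsimp only; omega, fun j => by have := j.2; dsimp only; omega⟩
    · exact ⟨⟨i.1 - 1, by omega⟩, i, ⟨i.1 + 1, by omega⟩, by dsimp only; omega,
        by dsimp only; omega, by dsimp only; omega, fun j => by have := j.2; dsimp only; omega⟩
  obtain ⟨a, b, c, hab, hac, hbc, h⟩ := key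
  rw [Finset.card_eq_three]
  refine ⟨a, b, c, hab, hac, hbc, ?_⟩
  ext j
  simp [h]

theorem H2n_isRegularOfDegree {n : ℕ} (hn : 6 ≤ n) : (H2n n).IsRegularOfDegree 3 := by
  rintro (i | i)
  · rw [← card_filter_H2nRel hn i, ← SimpleGraph.card_neighborFinset_eq_degree,
      ← Finset.card_map (β := Fin n ⊕ Fin n) (s := Finset.univ.filter _) Function.Embedding.inr]
    refine congr_arg Finset.card (Finset.ext ?_)
    rintro (j | j)
    · simp [H2n_not_adj_inl]
    · simp [H2n_adj_inl_inr]
  · rw [← card_filter_H2nRel hn i, ← SimpleGraph.card_neighborFinset_eq_degree,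
      ← Finset.card_map (β := Fin n ⊕ Fin n) (s := Finset.univ.filter _) Function.Embedding.inl]
    refine congr_arg Finset.card (Finset.ext ?_)
    rintro (j | j)
    · simp [H2n_adj_inr_inl, H2nRel_comm (i := j.1 + 1)]
    · simp [H2n_not_adj_inr]

/-! ### Energy of column functions on `H_{2n}` -/

/-- The function on the vertices of `H_{2n}` that is equal to `p i` on the `i`-th column. -/
def columnFun (n : ℕ) (p : ℕ → ℝ) : Fin n ⊕ Fin n → ℝ :=
  Sum.elim (fun i => p i) (fun i => p i)

theorem sum_columnFun (n : ℕ) (p : ℕ → ℝ) :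
    ∑ v, columnFun n p v = 2 * ∑ i ∈ Finset.range n, p i := by
  simp only [columnFun, Fintype.sum_sum_type, Sum.elim_inl, Sum.elim_inr, Finset.sum_range]
  ring

theorem sum_columnFun_sq (n : ℕ) (p : ℕ → ℝ) :
    ∑ v, columnFun n p v ^ 2 = 2 * ∑ i ∈ Finset.range n, p i ^ 2 := by
  simp only [columnFun, Fintype.sum_sum_type, Sum.elim_inl, Sum.elim_inr, Finset.sum_range]
  ring

/-- Meant for squared differences: since `F` vanishes on the diagonal, the rungs `u_i v_i`, and with
them the two missing ones, play no role. -/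
theorem sum_H2nRel (m : ℕ) (F : ℕ → ℕ → ℝ) (hF : ∀ i, F i i = 0) :
    (∑ i ∈ Finset.range (m + 6), ∑ j ∈ Finset.range (m + 6),
      if H2nRel (m + 6) (i + 1) (j + 1) then F i j else 0) =
    (∑ i ∈ Finset.range (m + 5), F i (i + 1)) + (∑ i ∈ Finset.range (m + 5), F (i + 1) i) +
      F 0 2 + F 2 0 + F (m + 3) (m + 5) + F (m + 5) (m + 3) := by
  have h : ∀ i ∈ Finset.range (m + 6), ∀ j ∈ Finset.range (m + 6),
      (if H2nRel (m + 6) (i + 1) (j + 1) then F i j else 0) =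
        (if i + 1 = j then F i j else 0) + (if i = j + 1 then F i j else 0) +
        (if i = 0 then if 2 = j then F i j else 0 else 0) +
        (if i = 2 then if 0 = j then F i j else 0 else 0) +
        (if i = m + 3 then if m + 5 = j then F i j else 0 else 0) +
        (if i = m + 5 then if m + 3 = j then F i j else 0 else 0) := by
    intro i _ j _
    by_cases hij : i = j
    · subst hij
      simp [hF]
    · by_cases hR : H2nRel (m + 6) (i + 1) (j + 1)
      · rw [if_pos hR]
        unfold H2nRel at hR
        by_cases h1 : i + 1 = j
        · rw [if_pos h1]; split_ifs <;> first | omega | simp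
        by_cases h2 : i = j + 1
        · rw [if_pos h2]; split_ifs <;> first | omega | simp
        split_ifs <;> first | omega | simp
      · rw [if_neg hR]
        unfold H2nRel at hR
        split_ifs <;> first | omega | simp
  rw [Finset.sum_congr rfl fun i hi => Finset.sum_congr rfl (h i hi)]
  simp only [Finset.sum_add_distrib]
  have h1 : (∑ i ∈ Finset.range (m + 6), ∑ j ∈ Finset.range (m + 6),
      if i + 1 = j then F i j else 0) = ∑ i ∈ Finset.range (m + 5), F i (i + 1) := by
    simp only [Finset.sum_ite_eq, Finset.mem_range]
    rw [Finset.sum_range_succ, if_neg (by omega), add_zero]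
    exact Finset.sum_congr rfl fun i hi => if_pos (by have := Finset.mem_range.1 hi; omega)
  have h2 : (∑ i ∈ Finset.range (m + 6), ∑ j ∈ Finset.range (m + 6),
      if i = j + 1 then F i j else 0) = ∑ i ∈ Finset.range (m + 5), F (i + 1) i := by
    rw [Finset.sum_comm]
    simp only [Finset.sum_ite_eq', Finset.mem_range]
    rw [Finset.sum_range_succ, if_neg (by omega), add_zero]
    exact Finset.sum_congr rfl fun i hi => if_pos (by have := Finset.mem_range.1 hi; omega)
  have h3 : ∀ a b, a < m + 6 → b < m + 6 → (∑ i ∈ Finset.range (m + 6),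
      ∑ j ∈ Finset.range (m + 6), if i = a then if b = j then F i j else 0 else 0) = F a b := by
    intro a b ha hb
    rw [Finset.sum_eq_single_of_mem a (by simpa using ha) fun i _ hi => by simp [hi]]
    simp [hb]
  rw [h1, h2, h3, h3, h3, h3] <;> omega

/-- The factor 4 at the ends counts the four edges between an end block and the next column, which
all see the same difference because `p` is constant on the block. Other neighbouring columns are
joined by two edges. -/
theorem dirichletEnergy_columnFun (m : ℕ) (p : ℕ → ℝ) (h0 : p 0 = p 1)
    (h1 : p (m + 5) = p (m + 4)) :
    dirichletEnergy (H2n (m + 6)) (columnFun (m + 6) p) =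
      4 * (p 2 - p 1) ^ 2 + 2 * ∑ j ∈ Finset.range (m + 1), (p (j + 3) - p (j + 2)) ^ 2 +
        4 * (p (m + 4) - p (m + 3)) ^ 2 := by
  have hs := sum_H2nRel m (fun i j => (p i - p j) ^ 2) (by simp)
  have hE : dirichletEnergy (H2n (m + 6)) (columnFun (m + 6) p) =
      ∑ i ∈ Finset.range (m + 6), ∑ j ∈ Finset.range (m + 6),
        if H2nRel (m + 6) (i + 1) (j + 1) then (p i - p j) ^ 2 else 0 := by
    simp only [dirichletEnergy, columnFun, Fintype.sum_sum_type, Sum.elim_inl, Sum.elim_inr,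
      Finset.sum_range, H2n_not_adj_inl, H2n_not_adj_inr, H2n_adj_inl_inr, H2n_adj_inr_inl,
      if_false, Finset.sum_const_zero, zero_add, add_zero]
    rw [div_eq_iff two_ne_zero, mul_two]
    congr 1
    refine Finset.sum_congr rfl fun i _ => Finset.sum_congr rfl fun j _ => ?_
    simp only [H2nRel_comm (i := j.1 + 1)]
  have hcomm : ∀ i, (p (i + 1) - p i) ^ 2 = (p i - p (i + 1)) ^ 2 := fun i => by ring
  rw [hE, hs]
  simp only [hcomm]
  rw [Finset.sum_range_succ' _ (m + 4), Finset.sum_range_succ' _ (m + 3),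
    Finset.sum_range_succ _ (m + 2), Finset.sum_range_succ _ (m + 1)]
  simp only [zero_add, h0, h1, add_assoc, Nat.reduceAdd]
  have : ∀ j, (p (j + 3) - p (j + 2)) ^ 2 = (p (j + 2) - p (j + 3)) ^ 2 := fun i => by ring
  simp only [this]
  ring

/-- The column function `1, 1, 1/2, 0, …, 0, -1/2, -1, -1` has squared norm 9 and energy at most 4.
All that matters later is that the bound lies below the constant `3/5` of `energy_blockAverage_le`.
-/
theorem spectralGap_H2n_le (m : ℕ) : spectralGap (H2n (m + 6)) ≤ 1 / 2 := by
  set p : ℕ → ℝ := fun i => if i ≤ 1 then 1 else if i = 2 then 1 / 2 else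
    if i = m + 3 then -1 / 2 else if m + 4 ≤ i then -1 else 0 with hp
  have p0 : p 0 = 1 := by simp [hp]
  have p1 : p 1 = 1 := by simp [hp]
  have p2 : p 2 = 1 / 2 := by simp [hp]
  have pm : ∀ j < m, p (j + 3) = 0 := fun j hj => by
    simp only [hp]
    rw [if_neg (by omega), if_neg (by omega), if_neg (by omega), if_neg (by omega)]
  have p3 : p (m + 3) = -1 / 2 := by simp [hp]
  have p4 : p (m + 4) = -1 := by simp [hp]
  have p5 : p (m + 5) = -1 := by simp [hp]
  have hsum : ∀ F : ℝ → ℝ, F 0 = 0 → ∑ i ∈ Finset.range (m + 6), F (p i) =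
      F 1 + F 1 + F (1 / 2) + F (-1 / 2) + F (-1) + F (-1) := by
    intro F hF
    rw [Finset.sum_range_succ, Finset.sum_range_succ, Finset.sum_range_succ,
      Finset.sum_range_succ', Finset.sum_range_succ', Finset.sum_range_succ',
      Finset.sum_eq_zero fun i hi => by
        simp only [add_assoc, Nat.reduceAdd]; rw [pm i (Finset.mem_range.1 hi), hF]]
    simp only [zero_add, Nat.reduceAdd, p0, p1, p2, p3, p4, p5]
    ring
  have hv := ((spectralGap_variational (H2n_connected (by omega))
    (H2n_isRegularOfDegree (n := m + 6) (by omega)) (by simp; omega)).2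
      (columnFun (m + 6) p) (by
        rw [sum_columnFun, show ∑ i ∈ Finset.range (m + 6), p i = _ from hsum id rfl]; norm_num)).1
  rw [sum_columnFun_sq, hsum (· ^ 2) (by simp),
    dirichletEnergy_columnFun m p (by rw [p0, p1]) (by rw [p4, p5]), p1, p2, p3, p4] at hv
  -- For `m = 0` there is a single jump of size 1; otherwise there are two jumps of size 1/2.
  have hm : ∑ j ∈ Finset.range (m + 1), (p (j + 3) - p (j + 2)) ^ 2 ≤ 1 := by
    rcases m with _ | m
    · simp only [zero_add, Finset.sum_range_one] at p3 ⊢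
      rw [p3, p2]; norm_num
    · rw [Finset.sum_range_succ, Finset.sum_range_succ',
        Finset.sum_eq_zero fun i hi => ?_]
      · have e := pm m (by omega)
        have e0 := pm 0 (by omega)
        rw [p3, show m + 1 + 2 = m + 3 by ring, e, e0]
        simp only [zero_add, p2]
        norm_num
      · have hi := Finset.mem_range.1 hi
        rw [pm (i + 1) (by omega), show i + 1 + 2 = i + 3 by ring, pm i (by omega)]
        simp
  linarith

/-! ### Energy as a quadratic form in the increments -/

/-- The number of edges between `{0, …, k}` and `{l + 1, …, N - 1}`, for the graph on `{0, …, N - 1}`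
with adjacency numbers `a`. -/
def crossing (N : ℕ) (a : ℕ → ℕ → ℕ) (k l : ℕ) : ℕ :=
  ∑ i ∈ Finset.range (k + 1), ∑ j ∈ Finset.Ico (l + 1) N, a i j

/-- The Dirichlet energy of `x` for the graph on `{0, …, N - 1}` with adjacency numbers `a`. -/
def orderedEnergy (N : ℕ) (a : ℕ → ℕ → ℕ) (x : ℕ → ℝ) : ℝ :=
  ∑ i ∈ Finset.range N, ∑ j ∈ Finset.Ico (i + 1) N, a i j * (x j - x i) ^ 2

/-- Expand `x j - x i` into increments and exchange sums: for `k ≤ l`, the edge `i j` contributes to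
the product of increments `k` and `l` exactly when `i ≤ k` and `l < j`, and `crossing` counts these
edges. -/
theorem orderedEnergy_eq_sum_crossing (N : ℕ) (a : ℕ → ℕ → ℕ) (x : ℕ → ℝ) :
    orderedEnergy N a x = ∑ k ∈ Finset.range (N - 1),
      (crossing N a k k * (x (k + 1) - x k) ^ 2 + ∑ l ∈ Finset.Ico (k + 1) (N - 1),
        2 * crossing N a k l * (x (k + 1) - x k) * (x (l + 1) - x l)) := by
  have h1 : ∀ i j, i ≤ j → (x j - x i) ^ 2 = ∑ k ∈ Finset.Ico i j,
      ((x (k + 1) - x k) ^ 2 +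
        ∑ l ∈ Finset.Ico (k + 1) j, 2 * (x (k + 1) - x k) * (x (l + 1) - x l)) := by
    intro i j hij
    have : ∀ k ∈ Finset.Ico i j, ((x (k + 1) - x k) ^ 2 +
        ∑ l ∈ Finset.Ico (k + 1) j, 2 * (x (k + 1) - x k) * (x (l + 1) - x l)) =
        -(x j - x (k + 1)) ^ 2 - -(x j - x k) ^ 2 := by
      intro k hk
      rw [← Finset.mul_sum, Finset.sum_Ico_sub x (by have := Finset.mem_Ico.1 hk; omega)]
      ring
    rw [Finset.sum_congr rfl this, Finset.sum_Ico_sub (fun k => -(x j - x k) ^ 2) hij]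
    ring
  have h2 : orderedEnergy N a x = ∑ i ∈ Finset.range N, ∑ j ∈ Finset.Ico (i + 1) N,
      ∑ k ∈ Finset.Ico i j, ((a i j : ℝ) * ((x (k + 1) - x k) ^ 2 +
        ∑ l ∈ Finset.Ico (k + 1) j, 2 * (x (k + 1) - x k) * (x (l + 1) - x l))) := by
    refine Finset.sum_congr rfl fun i _ => Finset.sum_congr rfl fun j hj => ?_
    rw [h1 i j (by have := Finset.mem_Ico.1 hj; omega), Finset.mul_sum]
  rw [h2, Finset.sum_congr rfl fun i _ => Finset.sum_comm' (s' := fun k => Finset.Ico (k + 1) N)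
    (t' := Finset.Ico i (N - 1)) (by intro j k; simp only [Finset.mem_Ico]; omega),
    Finset.sum_comm' (s' := fun k => Finset.range (k + 1)) (t' := Finset.range (N - 1))
      (by intro j k; simp only [Finset.mem_Ico, Finset.mem_range]; omega)]
  refine Finset.sum_congr rfl fun k _ => ?_
  simp only [mul_add, Finset.sum_add_distrib]
  congr 1
  · simp only [crossing, Nat.cast_sum, Finset.sum_mul]
  · have h3 : ∀ i, (∑ j ∈ Finset.Ico (k + 1) N, (a i j : ℝ) * ∑ l ∈ Finset.Ico (k + 1) j,
        2 * (x (k + 1) - x k) * (x (l + 1) - x l)) = ∑ l ∈ Finset.Ico (k + 1) (N - 1),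
          ∑ j ∈ Finset.Ico (l + 1) N, (a i j : ℝ) * (2 * (x (k + 1) - x k) * (x (l + 1) - x l)) := by
      intro i
      simp only [Finset.mul_sum]
      exact Finset.sum_comm' (by intro j k; simp only [Finset.mem_Ico]; omega)
    rw [Finset.sum_congr rfl fun i _ => h3 i, Finset.sum_comm]
    refine Finset.sum_congr rfl fun l _ => ?_
    simp only [crossing, Nat.cast_sum, Finset.sum_mul, Finset.mul_sum]
    refine Finset.sum_congr rfl fun i _ => Finset.sum_congr rfl fun j _ => ?_
    ring

/-- A lower bound for the energy by the pairs of cuts at distance at most three. -/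
theorem sum_crossing_le_orderedEnergy (N : ℕ) (a : ℕ → ℕ → ℕ) {x : ℕ → ℝ} (hx : Monotone x) :
    ∑ k ∈ Finset.range (N - 1), (crossing N a k k * (x (k + 1) - x k) ^ 2 +
      2 * crossing N a k (k + 1) * (x (k + 1) - x k) * (x (k + 1 + 1) - x (k + 1)) +
      2 * crossing N a k (k + 2) * (x (k + 1) - x k) * (x (k + 2 + 1) - x (k + 2)) +
      2 * crossing N a k (k + 3) * (x (k + 1) - x k) * (x (k + 3 + 1) - x (k + 3)))
      ≤ orderedEnergy N a x := by
  have hd : ∀ k, 0 ≤ x (k + 1) - x k := fun k => sub_nonneg.2 (hx (Nat.le_succ k))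
  rw [orderedEnergy_eq_sum_crossing]
  refine Finset.sum_le_sum fun k _ => ?_
  rw [add_assoc, add_assoc]
  refine add_le_add le_rfl ?_
  set g : ℕ → ℝ := fun l => 2 * crossing N a k l * (x (k + 1) - x k) * (x (l + 1) - x l) with hg
  have hg0 : ∀ l, 0 ≤ g l := fun l =>
    mul_nonneg (mul_nonneg (by positivity) (hd k)) (hd l)
  -- No vertex lies beyond `N - 1`, so the sum may be padded to contain three terms even near the
  -- right end.
  have hz : ∀ l, N - 1 ≤ l → g l = 0 := by
    intro l hl
    simp [hg, crossing, Finset.Ico_eq_empty_of_le (show N ≤ l + 1 by omega)]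
  calc _ = ∑ l ∈ Finset.Ico (k + 1) (k + 4), g l := by
        rw [Finset.sum_Ico_eq_sum_range, show k + 4 - (k + 1) = 3 by omega,
          Finset.sum_range_succ, Finset.sum_range_succ, Finset.sum_range_one]
        simp only [hg, add_assoc, Nat.reduceAdd, add_zero]
    _ ≤ ∑ l ∈ Finset.Ico (k + 1) (max (k + 4) (N - 1)), g l :=
        Finset.sum_le_sum_of_subset_of_nonneg
          (Finset.Ico_subset_Ico le_rfl (le_max_left _ _)) fun l _ _ => hg0 l
    _ = _ := by
        refine (Finset.sum_subset (Finset.Ico_subset_Ico le_rfl (le_max_right _ _)) ?_).symm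
        intro l h1 h2
        simp only [Finset.mem_Ico] at h1 h2
        exact hz l (by omega)

/-- A lower bound for the energy by the diagonal terms and any one off-diagonal term. -/
theorem sum_crossing_add_le_orderedEnergy {N : ℕ} (a : ℕ → ℕ → ℕ) {x : ℕ → ℝ} (hx : Monotone x)
    {k l : ℕ} (hkl : k < l) (hl : l < N - 1) :
    (∑ k ∈ Finset.range (N - 1), crossing N a k k * (x (k + 1) - x k) ^ 2) +
      2 * crossing N a k l * (x (k + 1) - x k) * (x (l + 1) - x l) ≤ orderedEnergy N a x := by
  have hd : ∀ k, 0 ≤ x (k + 1) - x k := fun k => sub_nonneg.2 (hx (Nat.le_succ k))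
  have h0 : ∀ k l, 0 ≤ 2 * crossing N a k l * (x (k + 1) - x k) * (x (l + 1) - x l) :=
    fun k l => mul_nonneg (mul_nonneg (by positivity) (hd k)) (hd l)
  rw [orderedEnergy_eq_sum_crossing, Finset.sum_add_distrib]
  refine add_le_add le_rfl ?_
  refine le_trans ?_ (Finset.single_le_sum (fun k _ => Finset.sum_nonneg fun l _ => h0 k l)
    (Finset.mem_range.2 (show k < N - 1 by omega)))
  exact Finset.single_le_sum (f := fun l => 2 * crossing N a k l * (x (k + 1) - x k) *
    (x (l + 1) - x l)) (fun l _ => h0 k l) (Finset.mem_Ico.2 ⟨by omega, hl⟩)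

/-! ### Cut sizes in ordered cubic bipartite graphs -/

/-- `a` and `b` are the adjacency numbers and a proper `2`-colouring of a cubic graph on
`{0, …, N - 1}` in which an edge leaves every proper initial segment. -/
structure OrderedCubic (N : ℕ) (a : ℕ → ℕ → ℕ) (b : ℕ → Bool) : Prop where
  le_one : ∀ i j, a i j ≤ 1
  symm : ∀ i j, a i j = a j i
  color : ∀ i j, b i = b j → a i j = 0
  deg : ∀ i < N, ∑ j ∈ Finset.range N, a i j = 3
  conn : ∀ k, k + 1 < N → 0 < crossing N a k k

namespace OrderedCubic

variable {N : ℕ} {a : ℕ → ℕ → ℕ} {b : ℕ → Bool}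

theorem crossing_add (h : OrderedCubic N a b) {k l : ℕ} (hk : k < N) (hl : l < N) :
    crossing N a k l + ∑ i ∈ Finset.range (k + 1), ∑ j ∈ Finset.range (l + 1), a i j =
      3 * (k + 1) := by
  rw [crossing, ← Finset.sum_add_distrib]
  have : ∀ i ∈ Finset.range (k + 1), ((∑ j ∈ Finset.Ico (l + 1) N, a i j) +
      ∑ j ∈ Finset.range (l + 1), a i j) = 3 := by
    intro i hi
    rw [add_comm, Finset.sum_range_add_sum_Ico _ (by omega)]
    exact h.deg i (by have := Finset.mem_range.1 hi; omega)
  rw [Finset.sum_congr rfl this]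
  simp [mul_comm]

/-- In the initial segment, `p` and `q` count the vertices of each colour, `t` and `u` the edges
leaving from each colour, and `s` the inner edges. Each inner edge has one end of either colour, so
the same `s` enters both degree counts. -/
theorem exists_colour_counts (h : OrderedCubic N a b) {k : ℕ} (hk : k < N) :
    ∃ p q s t u : ℕ, p + q = k + 1 ∧ t + s = 3 * p ∧ u + s = 3 * q ∧
      crossing N a k k = t + u := by
  classical
  set R := Finset.range (k + 1)
  have hdeg : ∀ i ∈ R, ((∑ j ∈ Finset.Ico (k + 1) N, a i j) + ∑ j ∈ R, a i j) = 3 := by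
    intro i hi
    rw [add_comm, Finset.sum_range_add_sum_Ico _ (by omega)]
    exact h.deg i (by have := Finset.mem_range.1 hi; omega)
  have hcol : ∀ c, ∀ i, b i = c → ∑ j ∈ R, a i j = ∑ j ∈ R with ¬ b j = c, a i j := by
    intro c i hi
    rw [← Finset.sum_filter_add_sum_filter_not R (fun j => b j = c), Finset.sum_eq_zero, zero_add]
    intro j hj
    exact h.color i j (hi.trans (Finset.mem_filter.1 hj).2.symm)
  refine ⟨(R.filter fun i => b i = true).card, (R.filter fun i => ¬ b i = true).card,
    ∑ i ∈ R with b i = true, ∑ j ∈ R, a i j,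
    ∑ i ∈ R with b i = true, ∑ j ∈ Finset.Ico (k + 1) N, a i j,
    ∑ i ∈ R with ¬ b i = true, ∑ j ∈ Finset.Ico (k + 1) N, a i j, ?_, ?_, ?_, ?_⟩
  · rw [Finset.card_filter_add_card_filter_not]; simp [R]
  · rw [← Finset.sum_add_distrib, Finset.sum_congr rfl fun i hi => hdeg i (Finset.mem_filter.1 hi).1]
    simp [mul_comm]
  · have : (∑ i ∈ R with b i = true, ∑ j ∈ R, a i j) =
        ∑ i ∈ R with ¬ b i = true, ∑ j ∈ R, a i j := by
      rw [Finset.sum_congr rfl fun i hi => hcol true i (Finset.mem_filter.1 hi).2,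
        Finset.sum_comm]
      refine Finset.sum_congr rfl fun i hi => ?_
      rw [hcol false i (by simpa using (Finset.mem_filter.1 hi).2)]
      refine Finset.sum_congr (by ext; simp) fun j _ => h.symm _ _
    rw [this, ← Finset.sum_add_distrib,
      Finset.sum_congr rfl fun i hi => hdeg i (Finset.mem_filter.1 hi).1]
    simp [mul_comm]
  · rw [Finset.sum_filter_add_sum_filter_not]; rfl

/-- The cut size is `3 (p + q) - 2 s` with `p + q = k + 1` even, and it is positive by
connectedness. -/
theorem crossing_odd (h : OrderedCubic N a b) {k : ℕ} (hk : k + 1 < N) (hodd : k % 2 = 1) :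
    2 ≤ crossing N a k k ∧ crossing N a k k % 2 = 0 := by
  obtain ⟨p, q, s, t, u, h1, h2, h3, h4⟩ := h.exists_colour_counts (k := k) (by omega)
  have := h.conn k hk
  omega

/-- Here `p + q` is odd, so `p ≠ q` and `t`, `u` differ by `3 |p - q| ≥ 3`. -/
theorem crossing_even (h : OrderedCubic N a b) {k : ℕ} (hk : k + 1 < N) (heven : k % 2 = 0) :
    3 ≤ crossing N a k k := by
  obtain ⟨p, q, s, t, u, h1, h2, h3, h4⟩ := h.exists_colour_counts (k := k) (by omega)
  have := h.conn k hk
  omega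

/-- Vertex `k + 1` has `crossing k k - crossing k (k + 1)` edges backwards and `crossing (k + 1) (k
+ 1) - crossing k (k + 1)` forwards, three in all. -/
theorem two_mul_crossing_succ (h : OrderedCubic N a b) {k : ℕ} (hk : k + 1 < N) :
    2 * crossing N a k (k + 1) + 3 = crossing N a k k + crossing N a (k + 1) (k + 1) := by
  have h1 := h.crossing_add (k := k) (l := k) (by omega) (by omega)
  have h2 := h.crossing_add (k := k + 1) (l := k + 1) hk hk
  have h3 := h.crossing_add (k := k) (l := k + 1) (by omega) hk
  have h4 := h.color (k + 1) (k + 1) rfl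
  simp only [Finset.sum_range_succ _ (k + 1), Finset.sum_add_distrib] at h2 h3
  have h5 : ∑ j ∈ Finset.range (k + 1), a (k + 1) j = ∑ i ∈ Finset.range (k + 1), a i (k + 1) :=
    Finset.sum_congr rfl fun i _ => h.symm _ _
  omega

theorem one_le_crossing_succ (h : OrderedCubic N a b) {k : ℕ} (hk : k + 2 < N) :
    1 ≤ crossing N a k (k + 1) := by
  have h1 := h.two_mul_crossing_succ (k := k) (by omega)
  rcases Nat.mod_two_eq_zero_or_one k with h2 | h2
  · have := h.crossing_even (k := k) (by omega) h2
    have := h.crossing_odd (k := k + 1) (by omega) (by omega)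
    omega
  · have := h.crossing_odd (k := k) (by omega) h2
    have := h.crossing_even (k := k + 1) (by omega) (by omega)
    omega

/-- The same graph with the vertices listed in the opposite order. -/
theorem reverse (h : OrderedCubic N a b) :
    OrderedCubic N (fun i j => a (N - 1 - i) (N - 1 - j)) (fun i => b (N - 1 - i)) ∧
    ∀ k l, k ≤ l → l + 1 < N → crossing N (fun i j => a (N - 1 - i) (N - 1 - j)) k l =
      crossing N a (N - 2 - l) (N - 2 - k) := by
  have hc : ∀ k l, k ≤ l → l + 1 < N → crossing N (fun i j => a (N - 1 - i) (N - 1 - j)) k l =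
      crossing N a (N - 2 - l) (N - 2 - k) := by
    intro k l hkl hl
    simp only [crossing, Finset.range_eq_Ico]
    rw [Finset.sum_Ico_reflect (fun i => ∑ j ∈ Finset.Ico (l + 1) N, a i (N - 1 - j)) 0
      (show k + 1 ≤ N - 1 + 1 by omega)]
    rw [Finset.sum_congr rfl fun i _ => Finset.sum_Ico_reflect (fun j => a i j) (l + 1)
      (show N ≤ N - 1 + 1 by omega), Finset.sum_comm]
    refine Finset.sum_congr (by congr 1 <;> omega) fun i _ =>
      Finset.sum_congr (by congr 1 <;> omega) fun j _ => h.symm _ _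
  refine ⟨⟨fun i j => h.le_one _ _, fun i j => h.symm _ _, fun i j hb => h.color _ _ hb, ?_, ?_⟩, hc⟩
  · intro i hi
    rw [Finset.sum_range_reflect (fun j => a (N - 1 - i) j)]
    exact h.deg _ (by omega)
  · intro k hk
    rw [hc k k le_rfl hk]
    exact h.conn _ (by omega)

theorem triangle_le (h : OrderedCubic N a b) (i j k : ℕ) : a i j + a i k + a j k ≤ 2 := by
  have h1 := h.le_one i j
  have h2 := h.le_one i k
  have h3 := h.le_one j k
  have : b i = b j ∨ b i = b k ∨ b j = b k := by
    cases b i <;> cases b j <;> cases b k <;> simp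
  rcases this with h' | h' | h' <;> have := h.color _ _ h' <;> omega

/-- The sizes of the cuts at the beginning of the order. -/
theorem crossing_initial (h : OrderedCubic N a b) (hN : 6 ≤ N) :
    crossing N a 0 0 = 3 ∧ 4 ≤ crossing N a 1 1 ∧ 5 ≤ crossing N a 2 2 ∧
    3 ≤ crossing N a 4 4 ∧ 2 ≤ crossing N a 0 1 ∧ 3 ≤ crossing N a 1 2 ∧
    2 ≤ crossing N a 3 4 ∧ 1 ≤ crossing N a 0 2 ∧ 1 ≤ crossing N a 2 4 ∧
    ((crossing N a 3 3 = 4 ∧ 3 ≤ crossing N a 2 3 ∧ crossing N a 0 3 = 1 ∧ crossing N a 1 3 = 2) ∨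
     (6 ≤ crossing N a 3 3 ∧ 4 ≤ crossing N a 2 3 ∧ 3 ≤ crossing N a 3 4 ∧
        2 ≤ crossing N a 1 3)) := by
  have c00 := h.crossing_add (k := 0) (l := 0) (by omega) (by omega)
  have c11 := h.crossing_add (k := 1) (l := 1) (by omega) (by omega)
  have c22 := h.crossing_add (k := 2) (l := 2) (by omega) (by omega)
  have c33 := h.crossing_add (k := 3) (l := 3) (by omega) (by omega)
  have c44 := h.crossing_even (k := 4) (by omega) (by omega)
  have c01 := h.crossing_add (k := 0) (l := 1) (by omega) (by omega)
  have c12 := h.crossing_add (k := 1) (l := 2) (by omega) (by omega)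
  have c23 := h.crossing_add (k := 2) (l := 3) (by omega) (by omega)
  have c34 : 2 * crossing N a 3 4 + 3 = crossing N a 3 3 + crossing N a 4 4 := h.two_mul_crossing_succ (k := 3) (by omega)
  have c02 := h.crossing_add (k := 0) (l := 2) (by omega) (by omega)
  have c13 := h.crossing_add (k := 1) (l := 3) (by omega) (by omega)
  have c24 := h.crossing_add (k := 2) (l := 4) (by omega) (by omega)
  have c03 := h.crossing_add (k := 0) (l := 3) (by omega) (by omega)
  simp only [Finset.sum_range_succ, Finset.sum_range_zero, zero_add, h.symm 1 0, h.symm 2 0,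
    h.symm 2 1, h.symm 3 0, h.symm 3 1, h.symm 3 2, h.color 0 0 rfl, h.color 1 1 rfl,
    h.color 2 2 rfl, h.color 3 3 rfl] at c00 c11 c22 c33 c01 c12 c23 c02 c13 c24 c03
  have e33 := h.crossing_odd (k := 3) (by omega) (by omega)
  have l01 := h.le_one 0 1
  have l02 := h.le_one 0 2
  have l03 := h.le_one 0 3
  have l12 := h.le_one 1 2
  have l13 := h.le_one 1 3
  have l23 := h.le_one 2 3
  have l04 := h.le_one 0 4
  have l14 := h.le_one 1 4
  have l24 := h.le_one 2 4
  have t012 := h.triangle_le 0 1 2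
  have t013 := h.triangle_le 0 1 3
  have t023 := h.triangle_le 0 2 3
  have t123 := h.triangle_le 1 2 3
  have t014 := h.triangle_le 0 1 4
  have t024 := h.triangle_le 0 2 4
  have t124 := h.triangle_le 1 2 4
  -- Each of the six pairs lies in two of the four triples, and no triple spans more than two edges.
  have he : a 0 1 + a 0 2 + a 0 3 + a 1 2 + a 1 3 + a 2 3 ≤ 4 := by
    clear * - t012 t013 t023 t123; omega
  refine ⟨by omega, by clear * - c11 l01; omega, by clear * - c22 t012; omega, c44,
    by clear * - c01 l01; omega, by clear * - c12 l01 t012; omega,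
    by clear * - c34 c33 he c44; omega, by clear * - c02 l01 l02; omega, ?_, ?_⟩
  · rcases Nat.lt_or_ge (a 0 1 + a 0 2 + a 0 3 + a 1 2 + a 1 3 + a 2 3) 4 with h4 | h4
    · clear * - c24 h4 t012 l04 l14 l24; omega
    -- With four inner edges every triple spans exactly two. So `{0, 1, 2}` contains an edge, and
    -- vertex 4 cannot be adjacent to both of its ends.
    · have h5 : a 0 1 + a 0 2 + a 1 2 = 2 := by
        clear * - t012 t013 t023 t123 h4; omega
      have h6 : a 0 4 + a 1 4 + a 2 4 ≤ 2 := by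
        clear * - h5 t014 t024 t124 l01 l02 l12; omega
      clear * - c24 h5 h6 he; omega
  -- The cut after four vertices is 12 minus twice the number of inner edges: at least 6, unless the
  -- first four vertices form a 4-cycle as in `H_{2n}`.
  · rcases Nat.lt_or_ge (a 0 1 + a 0 2 + a 0 3 + a 1 2 + a 1 3 + a 2 3) 4 with h4 | h4
    · right
      refine ⟨?_, ?_, ?_, ?_⟩
      · clear * - c33 h4; omega
      · clear * - c23 h4 t012; omega
      · clear * - c33 c34 c44 h4; omega
      · clear * - c13 h4 l01; omega
    · left
      refine ⟨?_, ?_, ?_, ?_⟩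
      · clear * - c33 he h4; omega
      · clear * - c23 he t012; omega
      · clear * - c03 he h4 t012 t013 t023 t123; omega
      · clear * - c13 he h4 t012 t013 t023 t123; omega

end OrderedCubic

/-! ### Block averages and the energy comparison -/

theorem sum_range_add_two_mul {M : Type*} [AddCommMonoid M] (F : ℕ → M) (s r : ℕ) :
    ∑ k ∈ Finset.range (s + 2 * r), F k =
      ∑ k ∈ Finset.range s, F k + ∑ j ∈ Finset.range r, (F (s + 2 * j) + F (s + 2 * j + 1)) := by
  induction r with
  | zero => simp
  | succ r ih =>
    rw [show s + 2 * (r + 1) = s + 2 * r + 1 + 1 by ring, Finset.sum_range_succ,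
      Finset.sum_range_succ, ih, Finset.sum_range_succ, add_assoc, add_assoc]

/-- The average of a sequence of length `2m + 12` over the blocks formed by its first four terms, its
last four terms, and the pairs of consecutive terms between; the outer blocks count twice. -/
noncomputable def blockAverage (m : ℕ) (x : ℕ → ℝ) (i : ℕ) : ℝ :=
  if i ≤ 1 then (x 0 + x 1 + x 2 + x 3) / 4
  else if m + 4 ≤ i then (x (2 * m + 8) + x (2 * m + 9) + x (2 * m + 10) + x (2 * m + 11)) / 4
  else (x (2 * i) + x (2 * i + 1)) / 2

section
variable (m : ℕ) (x : ℕ → ℝ)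

theorem blockAverage_zero : blockAverage m x 0 = (x 0 + x 1 + x 2 + x 3) / 4 := by
  simp [blockAverage]

theorem blockAverage_one : blockAverage m x 1 = (x 0 + x 1 + x 2 + x 3) / 4 := by
  simp [blockAverage]

theorem blockAverage_mid {m : ℕ} {j : ℕ} (hj : j < m + 2) :
    blockAverage m x (j + 2) = (x (2 * j + 4) + x (2 * j + 5)) / 2 := by
  rw [blockAverage, if_neg (by omega), if_neg (by omega)]; ring_nf

theorem blockAverage_last : blockAverage m x (m + 4) =
    (x (2 * m + 8) + x (2 * m + 9) + x (2 * m + 10) + x (2 * m + 11)) / 4 := by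
  rw [blockAverage, if_neg (by omega), if_pos (by omega)]

theorem blockAverage_last' : blockAverage m x (m + 5) =
    (x (2 * m + 8) + x (2 * m + 9) + x (2 * m + 10) + x (2 * m + 11)) / 4 := by
  rw [blockAverage, if_neg (by omega), if_pos (by omega)]

theorem sum_blockAverage (φ : ℝ → ℝ) : ∑ i ∈ Finset.range (m + 6), φ (blockAverage m x i) =
    2 * φ ((x 0 + x 1 + x 2 + x 3) / 4) +
      ∑ j ∈ Finset.range (m + 2), φ ((x (2 * j + 4) + x (2 * j + 5)) / 2) +
      2 * φ ((x (2 * m + 8) + x (2 * m + 9) + x (2 * m + 10) + x (2 * m + 11)) / 4) := by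
  rw [Finset.sum_range_succ, Finset.sum_range_succ, Finset.sum_range_succ', Finset.sum_range_succ',
    blockAverage_last, blockAverage_last']
  simp only [add_assoc, Nat.reduceAdd, zero_add, blockAverage_zero, blockAverage_one]
  rw [Finset.sum_congr rfl fun j hj => by rw [blockAverage_mid x (Finset.mem_range.1 hj)]]
  ring

theorem sum_range_blocks (F : ℕ → ℝ) : ∑ i ∈ Finset.range (2 * m + 12), F i =
    F 0 + F 1 + F 2 + F 3 + ∑ j ∈ Finset.range (m + 2), (F (2 * j + 4) + F (2 * j + 5)) +
      (F (2 * m + 8) + F (2 * m + 9) + F (2 * m + 10) + F (2 * m + 11)) := by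
  rw [Finset.sum_range_succ, Finset.sum_range_succ, Finset.sum_range_succ, Finset.sum_range_succ,
    show 2 * m + 8 = 4 + 2 * (m + 2) by ring, sum_range_add_two_mul F 4 (m + 2)]
  simp only [Finset.sum_range_succ _ 3, Finset.sum_range_succ _ 2, Finset.sum_range_succ _ 1,
    Finset.sum_range_one]
  rw [Finset.sum_congr rfl fun j _ => by rw [show 4 + 2 * j = 2 * j + 4 by ring]]
  simp only [add_assoc]

theorem sum_columnFun_blockAverage :
    ∑ v, columnFun (m + 6) (blockAverage m x) v = ∑ i ∈ Finset.range (2 * m + 12), x i := by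
  rw [sum_columnFun, sum_range_blocks m x,
    show ∑ i ∈ Finset.range (m + 6), blockAverage m x i = _ from sum_blockAverage m x id]
  simp only [id, ← Finset.sum_div]
  ring

/-- The squared deviation of `x` from its block averages. -/
theorem sum_sq_sub_sum_sq_blockAverage :
    ∑ i ∈ Finset.range (2 * m + 12), x i ^ 2 - ∑ v, columnFun (m + 6) (blockAverage m x) v ^ 2 =
      ((x 1 - x 0) ^ 2 + (x 2 - x 0) ^ 2 + (x 3 - x 0) ^ 2 + (x 2 - x 1) ^ 2 + (x 3 - x 1) ^ 2 +
        (x 3 - x 2) ^ 2) / 4 +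
      ∑ j ∈ Finset.range (m + 2), (x (2 * j + 5) - x (2 * j + 4)) ^ 2 / 2 +
      ((x (2 * m + 9) - x (2 * m + 8)) ^ 2 + (x (2 * m + 10) - x (2 * m + 8)) ^ 2 +
        (x (2 * m + 11) - x (2 * m + 8)) ^ 2 + (x (2 * m + 10) - x (2 * m + 9)) ^ 2 +
        (x (2 * m + 11) - x (2 * m + 9)) ^ 2 + (x (2 * m + 11) - x (2 * m + 10)) ^ 2) / 4 := by
  rw [sum_columnFun_sq, sum_range_blocks m (fun i => x i ^ 2), sum_blockAverage m x (· ^ 2)]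
  have : ∑ j ∈ Finset.range (m + 2), (x (2 * j + 5) - x (2 * j + 4)) ^ 2 / 2 =
      ∑ j ∈ Finset.range (m + 2), (x (2 * j + 4) ^ 2 + x (2 * j + 5) ^ 2) -
      2 * ∑ j ∈ Finset.range (m + 2), ((x (2 * j + 4) + x (2 * j + 5)) / 2) ^ 2 := by
    rw [Finset.mul_sum, ← Finset.sum_sub_distrib]
    refine Finset.sum_congr rfl fun j _ => ?_
    ring
  rw [this]
  ring

end

/-- The contribution of one end of the order to the energy estimate. -/
theorem end_energy_le {d₀ d₁ d₂ d₃ d₄ c00 c11 c22 c33 c44 c01 c12 c23 c34 c02 c13 c24 c03 : ℝ}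
    (h0 : 0 ≤ d₀) (h1 : 0 ≤ d₁) (h2 : 0 ≤ d₂) (h3 : 0 ≤ d₃) (h4 : 0 ≤ d₄)
    (k00 : 3 ≤ c00) (k11 : 4 ≤ c11) (k22 : 5 ≤ c22) (k44 : 3 ≤ c44) (k01 : 2 ≤ c01)
    (k12 : 3 ≤ c12) (k34 : 2 ≤ c34) (k02 : 1 ≤ c02) (k24 : 1 ≤ c24) (k13 : 2 ≤ c13)
    (hc : (4 ≤ c33 ∧ 3 ≤ c23 ∧ 1 ≤ c03) ∨ (6 ≤ c33 ∧ 4 ≤ c23 ∧ 3 ≤ c34 ∧ 0 ≤ c03)) :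
    4 * (d₃ + d₄ / 2 + (d₀ + 2 * d₁ + 3 * d₂) / 4) ^ 2 +
      3 / 5 * ((d₀ ^ 2 + (d₀ + d₁) ^ 2 + (d₀ + d₁ + d₂) ^ 2 + d₁ ^ 2 + (d₁ + d₂) ^ 2 + d₂ ^ 2) / 4 +
        d₄ ^ 2 / 2) + d₄ ^ 2 ≤
      c00 * d₀ ^ 2 + c11 * d₁ ^ 2 + c22 * d₂ ^ 2 + c33 * d₃ ^ 2 + c44 * d₄ ^ 2 +
      2 * c01 * d₀ * d₁ + 2 * c12 * d₁ * d₂ + 2 * c23 * d₂ * d₃ + 2 * c34 * d₃ * d₄ +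
      2 * c02 * d₀ * d₂ + 2 * c13 * d₁ * d₃ + 2 * c24 * d₂ * d₄ + 2 * c03 * d₀ * d₃ := by
  have e00 := mul_le_mul_of_nonneg_right k00 (sq_nonneg d₀)
  have e11 := mul_le_mul_of_nonneg_right k11 (sq_nonneg d₁)
  have e22 := mul_le_mul_of_nonneg_right k22 (sq_nonneg d₂)
  have e44 := mul_le_mul_of_nonneg_right k44 (sq_nonneg d₄)
  have e01 := mul_le_mul_of_nonneg_right k01 (mul_nonneg h0 h1)
  have e12 := mul_le_mul_of_nonneg_right k12 (mul_nonneg h1 h2)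
  have e02 := mul_le_mul_of_nonneg_right k02 (mul_nonneg h0 h2)
  have e24 := mul_le_mul_of_nonneg_right k24 (mul_nonneg h2 h4)
  have e13 := mul_le_mul_of_nonneg_right k13 (mul_nonneg h1 h3)
  have e34 := mul_le_mul_of_nonneg_right k34 (mul_nonneg h3 h4)
  -- The square of `d₄` has `3 - 1 - 3/10 - 1 = 7/10` to spare, and after `c24 ≥ 1` the uncovered
  -- products are `d₄ (d₀ + 2 d₁ + d₂)`. One seventieth of this square matches both.
  have s1 := sq_nonneg (7 * d₄ - 5 * (d₀ + 2 * d₁ + d₂))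
  have s2 := sq_nonneg (d₀ - d₂)
  have p01 := mul_nonneg h0 h1
  have p12 := mul_nonneg h1 h2
  have p02 := mul_nonneg h0 h2
  have p23 := mul_nonneg h2 h3
  rcases hc with ⟨k33, k23, k03⟩ | ⟨k33, k23, -, k03⟩
  · have e33 := mul_le_mul_of_nonneg_right k33 (sq_nonneg d₃)
    have e23 := mul_le_mul_of_nonneg_right k23 (mul_nonneg h2 h3)
    have e03 := mul_le_mul_of_nonneg_right k03 (mul_nonneg h0 h3)
    linarith [sq_nonneg d₀, sq_nonneg d₁, sq_nonneg d₂]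
  · have e33 := mul_le_mul_of_nonneg_right k33 (sq_nonneg d₃)
    have e23 := mul_le_mul_of_nonneg_right k23 (mul_nonneg h2 h3)
    have e03 := mul_le_mul_of_nonneg_right k03 (mul_nonneg h0 h3)
    -- Now `c03` may vanish; the product `2 d₀ d₃` is absorbed by the extra `2 d₃²` coming from `c33
    -- ≥ 6`.
    linarith [sq_nonneg d₀, sq_nonneg d₁, sq_nonneg d₂, sq_nonneg (2 * d₃ - d₀)]

-- The difference of neighbouring pair averages is the increment between the pairs plus half of the
-- increments inside them. The coefficient 3 of an inner increment pays for its share in both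
-- neighbouring differences, via `(s + t)² / 2 ≤ s² + t²`, and for the deviation term. The ends are
-- treated by `end_energy_le`, which leaves one square of the adjacent inner increment for the
-- middle.
set_option maxHeartbeats 1000000 in
theorem energy_blockAverage_le {m : ℕ} {a : ℕ → ℕ → ℕ} {b : ℕ → Bool}
    (h : OrderedCubic (2 * m + 12) a b) {x : ℕ → ℝ} (hx : Monotone x) :
    dirichletEnergy (H2n (m + 6)) (columnFun (m + 6) (blockAverage m x)) +
      3 / 5 * (∑ i ∈ Finset.range (2 * m + 12), x i ^ 2 -
        ∑ v, columnFun (m + 6) (blockAverage m x) v ^ 2) ≤ orderedEnergy (2 * m + 12) a x := by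
  set d : ℕ → ℝ := fun k => x (k + 1) - x k with hd
  have hd0 : ∀ k, 0 ≤ d k := fun k => sub_nonneg.2 (hx (Nat.le_succ k))
  set C : ℕ → ℕ → ℝ := fun k l => crossing (2 * m + 12) a k l with hC
  have hC0 : ∀ k l, 0 ≤ C k l := fun k l => Nat.cast_nonneg _
  have hcast : ∀ {q k l : ℕ}, q ≤ crossing (2 * m + 12) a k l → (q : ℝ) ≤ C k l :=
    fun hq => Nat.cast_le.2 hq
  set F : ℕ → ℝ := fun k => C k k * d k ^ 2 + 2 * C k (k + 1) * d k * d (k + 1) +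
    2 * C k (k + 2) * d k * d (k + 2) + 2 * C k (k + 3) * d k * d (k + 3) with hF
  have hFle : ∀ k, C k k * d k ^ 2 + 2 * C k (k + 1) * d k * d (k + 1) ≤ F k := by
    intro k
    have h2 : 0 ≤ 2 * C k (k + 2) * d k * d (k + 2) :=
      mul_nonneg (mul_nonneg (mul_nonneg two_pos.le (hC0 _ _)) (hd0 _)) (hd0 _)
    have h3 : 0 ≤ 2 * C k (k + 3) * d k * d (k + 3) :=
      mul_nonneg (mul_nonneg (mul_nonneg two_pos.le (hC0 _ _)) (hd0 _)) (hd0 _)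
    simp only [hF]
    linarith
  have hFodd : ∀ k, k + 2 < 2 * m + 12 → k % 2 = 1 →
      2 * d k ^ 2 + 2 * d k * d (k + 1) ≤ F k := by
    intro k hk hodd
    have h1 : (2 : ℝ) ≤ C k k := by exact_mod_cast hcast (h.crossing_odd (by omega) hodd).1
    have h2 : (1 : ℝ) ≤ C k (k + 1) := by exact_mod_cast hcast (h.one_le_crossing_succ hk)
    have h3 := mul_le_mul_of_nonneg_right h1 (sq_nonneg (d k))
    have h4 := mul_le_mul_of_nonneg_right h2 (mul_nonneg (hd0 k) (hd0 (k + 1)))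
    linarith [hFle k]
  have hFeven : ∀ k, k + 2 < 2 * m + 12 → k % 2 = 0 →
      3 * d k ^ 2 + 2 * d k * d (k + 1) ≤ F k := by
    intro k hk heven
    have h1 : (3 : ℝ) ≤ C k k := by exact_mod_cast hcast (h.crossing_even (by omega) heven)
    have h2 : (1 : ℝ) ≤ C k (k + 1) := by exact_mod_cast hcast (h.one_le_crossing_succ hk)
    have h3 := mul_le_mul_of_nonneg_right h1 (sq_nonneg (d k))
    have h4 := mul_le_mul_of_nonneg_right h2 (mul_nonneg (hd0 k) (hd0 (k + 1)))
    linarith [hFle k]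
  -- The terms in `d (4 + 2 * r)` are the credit passed from pair to pair: its square and its
  -- product with the next increment are what the following difference needs from the left.
  have hmid : ∀ r ≤ m, ∑ j ∈ Finset.range r,
      (2 * (d (5 + 2 * j) + (d (4 + 2 * j) + d (6 + 2 * j)) / 2) ^ 2 +
        3 / 10 * d (6 + 2 * j) ^ 2) +
      2 * d (4 + 2 * r) * d (5 + 2 * r) + d (4 + 2 * r) ^ 2 ≤ 2 * d 4 * d 5 + d 4 ^ 2 +
        ∑ j ∈ Finset.range r, (F (5 + 2 * j) + F (5 + 2 * j + 1)) := by
    intro r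
    induction r with
    | zero => intro _; simp
    | succ r ih =>
      intro hr
      have h1 := ih (by omega)
      have h2 := hFodd (5 + 2 * r) (by omega) (by omega)
      have h3 := hFeven (5 + 2 * r + 1) (by omega) (by omega)
      rw [Finset.sum_range_succ, Finset.sum_range_succ]
      rw [show 4 + 2 * (r + 1) = 5 + 2 * r + 1 by ring, show 5 + 2 * (r + 1) = 5 + 2 * r + 1 + 1 by
        ring, show 6 + 2 * r = 5 + 2 * r + 1 by ring]
      linarith [sq_nonneg (d (4 + 2 * r) - d (5 + 2 * r + 1)), sq_nonneg (d (5 + 2 * r + 1))]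
  obtain ⟨k00, k11, k22, k44, k01, k12, k34, k02, k24, k3⟩ := h.crossing_initial (by omega)
  have hleft := end_energy_le (hd0 0) (hd0 1) (hd0 2) (hd0 3) (hd0 4) (c00 := C 0 0) (c11 := C 1 1)
    (c22 := C 2 2) (c33 := C 3 3) (c44 := C 4 4) (c01 := C 0 1) (c12 := C 1 2) (c23 := C 2 3)
    (c34 := C 3 4) (c02 := C 0 2) (c13 := C 1 3) (c24 := C 2 4) (c03 := C 0 3)
    (by exact_mod_cast hcast k00.ge) (by exact_mod_cast hcast k11) (by exact_mod_cast hcast k22)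
    (by exact_mod_cast hcast k44) (by exact_mod_cast hcast k01) (by exact_mod_cast hcast k12)
    (by exact_mod_cast hcast k34) (by exact_mod_cast hcast k02) (by exact_mod_cast hcast k24)
    (by have : 2 ≤ crossing (2 * m + 12) a 1 3 := by omega
        exact_mod_cast hcast this)
    (by rcases k3 with ⟨e1, e2, e3, -⟩ | ⟨e1, e2, e3, -⟩
        · exact Or.inl ⟨by exact_mod_cast hcast e1.ge, by exact_mod_cast hcast e2, by exact_mod_cast hcast e3.ge⟩
        · exact Or.inr ⟨by exact_mod_cast hcast e1, by exact_mod_cast hcast e2, by exact_mod_cast hcast e3, hC0 _ _⟩)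
  clear k00 k11 k22 k44 k01 k12 k34 k02 k24 k3
  -- The right end is the left end of the reversed order.
  obtain ⟨hr, hrc⟩ := h.reverse
  obtain ⟨k00, k11, k22, k44, k01, k12, k34, k02, k24, k3⟩ := hr.crossing_initial (by omega)
  rw [hrc _ _ (by omega) (by omega), show 2 * m + 12 - 2 - 0 = 2 * m + 10 by omega] at k00
  rw [hrc _ _ (by omega) (by omega), show 2 * m + 12 - 2 - 1 = 2 * m + 9 by omega] at k11
  rw [hrc _ _ (by omega) (by omega), show 2 * m + 12 - 2 - 2 = 2 * m + 8 by omega] at k22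
  rw [hrc _ _ (by omega) (by omega), show 2 * m + 12 - 2 - 4 = 2 * m + 6 by omega] at k44
  rw [hrc _ _ (by omega) (by omega), show 2 * m + 12 - 2 - 0 = 2 * m + 10 by omega,
    show 2 * m + 12 - 2 - 1 = 2 * m + 9 by omega] at k01
  rw [hrc _ _ (by omega) (by omega), show 2 * m + 12 - 2 - 1 = 2 * m + 9 by omega,
    show 2 * m + 12 - 2 - 2 = 2 * m + 8 by omega] at k12
  rw [hrc _ _ (by omega) (by omega), show 2 * m + 12 - 2 - 3 = 2 * m + 7 by omega,
    show 2 * m + 12 - 2 - 4 = 2 * m + 6 by omega] at k34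
  rw [hrc _ _ (by omega) (by omega), show 2 * m + 12 - 2 - 0 = 2 * m + 10 by omega,
    show 2 * m + 12 - 2 - 2 = 2 * m + 8 by omega] at k02
  rw [hrc _ _ (by omega) (by omega), show 2 * m + 12 - 2 - 2 = 2 * m + 8 by omega,
    show 2 * m + 12 - 2 - 4 = 2 * m + 6 by omega] at k24
  rw [hrc 3 3 (by omega) (by omega), hrc 2 3 (by omega) (by omega), hrc 0 3 (by omega) (by omega),
    hrc 1 3 (by omega) (by omega), hrc 3 4 (by omega) (by omega),
    show 2 * m + 12 - 2 - 0 = 2 * m + 10 by omega,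
    show 2 * m + 12 - 2 - 1 = 2 * m + 9 by omega, show 2 * m + 12 - 2 - 2 = 2 * m + 8 by omega,
    show 2 * m + 12 - 2 - 3 = 2 * m + 7 by omega, show 2 * m + 12 - 2 - 4 = 2 * m + 6 by omega] at k3
  have hright := end_energy_le (hd0 (2 * m + 10)) (hd0 (2 * m + 9)) (hd0 (2 * m + 8))
    (hd0 (2 * m + 7)) (hd0 (2 * m + 6)) (c00 := C (2 * m + 10) (2 * m + 10))
    (c11 := C (2 * m + 9) (2 * m + 9))
    (c22 := C (2 * m + 8) (2 * m + 8)) (c33 := C (2 * m + 7) (2 * m + 7))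
    (c44 := C (2 * m + 6) (2 * m + 6)) (c01 := C (2 * m + 9) (2 * m + 10))
    (c12 := C (2 * m + 8) (2 * m + 9)) (c23 := C (2 * m + 7) (2 * m + 8))
    (c34 := C (2 * m + 6) (2 * m + 7)) (c02 := C (2 * m + 8) (2 * m + 10))
    (c13 := C (2 * m + 7) (2 * m + 9)) (c24 := C (2 * m + 6) (2 * m + 8))
    (c03 := C (2 * m + 7) (2 * m + 10))
    (by exact_mod_cast hcast k00.ge) (by exact_mod_cast hcast k11) (by exact_mod_cast hcast k22)
    (by exact_mod_cast hcast k44) (by exact_mod_cast hcast k01) (by exact_mod_cast hcast k12)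
    (by exact_mod_cast hcast k34) (by exact_mod_cast hcast k02) (by exact_mod_cast hcast k24)
    (by have : 2 ≤ crossing (2 * m + 12) a (2 * m + 7) (2 * m + 9) := by omega
        exact_mod_cast hcast this)
    (by rcases k3 with ⟨e1, e2, e3, -⟩ | ⟨e1, e2, e3, -⟩
        · exact Or.inl ⟨by exact_mod_cast hcast e1.ge, by exact_mod_cast hcast e2, by exact_mod_cast hcast e3.ge⟩
        · exact Or.inr ⟨by exact_mod_cast hcast e1, by exact_mod_cast hcast e2, by exact_mod_cast hcast e3, hC0 _ _⟩)
  have hE := sum_crossing_le_orderedEnergy (2 * m + 12) a hx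
  change ∑ k ∈ Finset.range (2 * m + 11), F k ≤ _ at hE
  have hsplit : ∑ k ∈ Finset.range (2 * m + 11), F k = F 0 + F 1 + F 2 + F 3 + F 4 +
      ∑ j ∈ Finset.range m, (F (5 + 2 * j) + F (5 + 2 * j + 1)) + F (2 * m + 5) + F (2 * m + 6) +
      F (2 * m + 7) + F (2 * m + 8) + F (2 * m + 9) + F (2 * m + 10) := by
    rw [Finset.sum_range_succ, Finset.sum_range_succ, Finset.sum_range_succ, Finset.sum_range_succ,
      Finset.sum_range_succ, Finset.sum_range_succ, show 2 * m + 5 = 5 + 2 * m by ring,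
      sum_range_add_two_mul F 5 m]
    simp only [Finset.sum_range_succ _ 4, Finset.sum_range_succ _ 3, Finset.sum_range_succ _ 2,
      Finset.sum_range_succ _ 1, Finset.sum_range_one]
  rw [hsplit] at hE
  refine le_trans ?_ hE
  have hm := hmid m le_rfl
  have hF5 := hFodd (2 * m + 5) (by omega) (by omega)
  have hcd : ∀ k l, 0 ≤ 2 * C k l * d k * d l := fun k l =>
    mul_nonneg (mul_nonneg (mul_nonneg two_pos.le (hC0 _ _)) (hd0 _)) (hd0 _)
  have hF' : ∀ k, F k = C k k * d k ^ 2 + 2 * C k (k + 1) * d k * d (k + 1) +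
    2 * C k (k + 2) * d k * d (k + 2) + 2 * C k (k + 3) * d k * d (k + 3) := fun k => rfl
  have h45 : 2 * d 4 * d 5 ≤ 2 * C 4 5 * d 4 * d 5 := by
    have h2 : (1 : ℝ) ≤ C 4 5 := by
      exact_mod_cast hcast (h.one_le_crossing_succ (k := 4) (by omega))
    have h4 := mul_le_mul_of_nonneg_right h2 (mul_nonneg (hd0 4) (hd0 5))
    linarith
  have hp1 : blockAverage m x 2 - blockAverage m x 1 =
      d 3 + d 4 / 2 + (d 0 + 2 * d 1 + 3 * d 2) / 4 := by
    rw [blockAverage_one, blockAverage_mid x (show 0 < m + 2 by omega)]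
    simp only [hd]; ring_nf
  have hp2 : blockAverage m x (m + 4) - blockAverage m x (m + 3) =
      d (2 * m + 7) + d (2 * m + 6) / 2 +
        (d (2 * m + 10) + 2 * d (2 * m + 9) + 3 * d (2 * m + 8)) / 4 := by
    rw [blockAverage_last, show m + 3 = m + 1 + 2 by ring,
      blockAverage_mid x (show m + 1 < m + 2 by omega)]
    simp only [hd, show 2 * (m + 1) + 4 = 2 * m + 6 by ring,
      show 2 * (m + 1) + 5 = 2 * m + 7 by ring, add_assoc, Nat.reduceAdd]
    ring
  have hpm : ∑ j ∈ Finset.range (m + 1), (blockAverage m x (j + 3) - blockAverage m x (j + 2)) ^ 2 =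
      ∑ j ∈ Finset.range (m + 1), (d (5 + 2 * j) + (d (4 + 2 * j) + d (6 + 2 * j)) / 2) ^ 2 := by
    refine Finset.sum_congr rfl fun j hj => ?_
    have hj := Finset.mem_range.1 hj
    rw [show j + 3 = j + 1 + 2 by ring, blockAverage_mid x (show j + 1 < m + 2 by omega),
      blockAverage_mid x (show j < m + 2 by omega)]
    simp only [hd, show 2 * (j + 1) + 4 = 2 * j + 6 by ring,
      show 2 * (j + 1) + 5 = 2 * j + 7 by ring, show 5 + 2 * j = 2 * j + 5 by ring,
      show 4 + 2 * j = 2 * j + 4 by ring, show 6 + 2 * j = 2 * j + 6 by ring, add_assoc,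
      Nat.reduceAdd]
    ring
  have hdm : ∑ j ∈ Finset.range (m + 2), (x (2 * j + 5) - x (2 * j + 4)) ^ 2 / 2 =
      d 4 ^ 2 / 2 + ∑ j ∈ Finset.range m, d (6 + 2 * j) ^ 2 / 2 + d (2 * m + 6) ^ 2 / 2 := by
    rw [Finset.sum_range_succ, Finset.sum_range_succ']
    have : ∀ j, x (2 * (j + 1) + 5) - x (2 * (j + 1) + 4) = d (6 + 2 * j) := fun j => by
      simp only [hd]; ring_nf
    simp only [this, show 6 + 2 * m = 2 * m + 6 by ring]
    simp only [hd]; ring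
  rw [dirichletEnergy_columnFun m _ (by rw [blockAverage_zero, blockAverage_one])
    (by rw [blockAverage_last, blockAverage_last']), sum_sq_sub_sum_sq_blockAverage, hp1, hp2, hpm,
    hdm, Finset.sum_range_succ]
  simp only [Finset.sum_add_distrib, ← Finset.mul_sum, ← Finset.sum_div] at hm ⊢
  simp only [show 5 + 2 * m = 2 * m + 5 by ring, show 4 + 2 * m = 2 * m + 4 by ring,
    show 6 + 2 * m = 2 * m + 6 by ring] at hm ⊢
  have hU := sq_nonneg (d (2 * m + 4) - d (2 * m + 6))
  have f0 := hF' 0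
  have f1 := hF' 1
  have f2 := hF' 2
  have f3 := hF' 3
  have f4 := hF' 4
  have f6 := hF' (2 * m + 6)
  have f7 := hF' (2 * m + 7)
  have f8 := hF' (2 * m + 8)
  have f9 := hF' (2 * m + 9)
  have f10 := hF' (2 * m + 10)
  simp only [zero_add, add_assoc (2 * m), Nat.reduceAdd] at f0 f1 f2 f3 f4 f6 f7 f8 f9 f10 hF5 hm
  -- Products occurring in `F` but not used by the end estimates; being nonnegative, they are
  -- dropped. Indices past the last vertex are harmless because `x` is monotone on all of `ℕ`.
  have g1 := hcd 1 4
  have g2 := hcd 2 5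
  have g3 := hcd 3 5
  have g3' := hcd 3 6
  have g4 := hcd 4 6
  have g4' := hcd 4 7
  have g6 := hcd (2 * m + 6) (2 * m + 9)
  have g8 := hcd (2 * m + 8) (2 * m + 11)
  have g9 := hcd (2 * m + 9) (2 * m + 11)
  have g9' := hcd (2 * m + 9) (2 * m + 12)
  have g10 := hcd (2 * m + 10) (2 * m + 11)
  have g10' := hcd (2 * m + 10) (2 * m + 12)
  have g10'' := hcd (2 * m + 10) (2 * m + 13)
  have e10 : x 1 - x 0 = d 0 := rfl
  have e21 : x 2 - x 1 = d 1 := rfl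
  have e32 : x 3 - x 2 = d 2 := rfl
  have e20 : x 2 - x 0 = d 0 + d 1 := by linarith
  have e30 : x 3 - x 0 = d 0 + d 1 + d 2 := by linarith
  have e31 : x 3 - x 1 = d 1 + d 2 := by linarith
  have y10 : x (2 * m + 9) - x (2 * m + 8) = d (2 * m + 8) := rfl
  have y21 : x (2 * m + 10) - x (2 * m + 9) = d (2 * m + 9) := rfl
  have y32 : x (2 * m + 11) - x (2 * m + 10) = d (2 * m + 10) := rfl
  have y20 : x (2 * m + 10) - x (2 * m + 8) = d (2 * m + 8) + d (2 * m + 9) := by linarith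
  have y30 : x (2 * m + 11) - x (2 * m + 8) = d (2 * m + 8) + d (2 * m + 9) + d (2 * m + 10) := by
    linarith
  have y31 : x (2 * m + 11) - x (2 * m + 9) = d (2 * m + 9) + d (2 * m + 10) := by linarith
  rw [e10, e21, e32, e20, e30, e31, y10, y21, y32, y20, y30, y31]
  clear e10 e21 e32 e20 e30 e31 y10 y21 y32 y20 y30 y31
  have hL : 4 * (d 3 + d 4 / 2 + (d 0 + 2 * d 1 + 3 * d 2) / 4) ^ 2 +
      3 / 5 * ((d 0 ^ 2 + (d 0 + d 1) ^ 2 + (d 0 + d 1 + d 2) ^ 2 + d 1 ^ 2 + (d 1 + d 2) ^ 2 +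
        d 2 ^ 2) / 4 + d 4 ^ 2 / 2) + d 4 ^ 2 + 2 * d 4 * d 5 ≤ F 0 + F 1 + F 2 + F 3 + F 4 := by
    linarith only [hleft, f0, f1, f2, f3, f4, g1, g2, g3, g3', g4, g4', h45]
  have hR : 4 * (d (2 * m + 7) + d (2 * m + 6) / 2 +
        (d (2 * m + 10) + 2 * d (2 * m + 9) + 3 * d (2 * m + 8)) / 4) ^ 2 +
      3 / 5 * ((d (2 * m + 10) ^ 2 + (d (2 * m + 10) + d (2 * m + 9)) ^ 2 +
        (d (2 * m + 10) + d (2 * m + 9) + d (2 * m + 8)) ^ 2 + d (2 * m + 9) ^ 2 +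
        (d (2 * m + 9) + d (2 * m + 8)) ^ 2 + d (2 * m + 8) ^ 2) / 4 + d (2 * m + 6) ^ 2 / 2) +
        d (2 * m + 6) ^ 2 ≤
      F (2 * m + 6) + F (2 * m + 7) + F (2 * m + 8) + F (2 * m + 9) + F (2 * m + 10) := by
    linarith only [hright, f6, f7, f8, f9, f10, g6, g8, g9, g9', g10, g10', g10'']
  linarith only [hL, hR, hm, hF5, hU]

/-! ### Monotone eigenfunctions of `H_{2n}` -/

theorem spectralGap_pos {V : Type*} [Fintype V] [DecidableEq V] {G : SimpleGraph V}
    [DecidableRel G.Adj] {d : ℕ} (hG : G.Connected) (hd : G.IsRegularOfDegree d)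
    (hc : 2 ≤ Fintype.card V) : 0 < spectralGap G := by
  obtain ⟨x, h1, h2, h3⟩ := (spectralGap_variational hG hd hc).1
  rw [← h3]
  refine lt_of_le_of_ne (dirichletEnergy_nonneg x) fun h => ?_
  have hx := eq_of_dirichletEnergy_eq_zero hG h.symm
  have h0 : ∀ v, x v = 0 := by
    intro v
    rw [Finset.sum_congr rfl fun u _ => hx u v, Finset.sum_const, smul_eq_zero,
      Finset.card_univ] at h1
    exact h1.resolve_left (by omega)
  simp [h0] at h2

/-- A monotone sequence with sum zero and a nonnegative proper partial sum vanishes. -/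
theorem eq_zero_of_sum_nonneg {p : ℕ → ℝ} (hp : Monotone p) {n : ℕ}
    (hs : ∑ k ∈ Finset.range n, p k = 0) {i : ℕ} (hi : i + 1 < n)
    (h : 0 ≤ ∑ k ∈ Finset.range (i + 1), p k) : ∀ k < n, p k = 0 := by
  have hi0 : 0 ≤ p i := by
    by_contra hneg
    have : ∑ k ∈ Finset.range (i + 1), p k < 0 :=
      Finset.sum_neg (fun k hk => lt_of_le_of_lt (hp (by have := Finset.mem_range.1 hk; omega))
        (not_le.1 hneg)) ⟨0, by simp⟩
    linarith
  have hnn : ∀ k ∈ Finset.Ico (i + 1) n, 0 ≤ p k := fun k hk =>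
    hi0.trans (hp (by have := Finset.mem_Ico.1 hk; omega))
  have hz : ∑ k ∈ Finset.Ico (i + 1) n, p k = 0 := by
    refine le_antisymm ?_ (Finset.sum_nonneg hnn)
    rw [← Finset.sum_range_add_sum_Ico _ hi.le] at hs
    linarith
  rw [Finset.sum_eq_zero_iff_of_nonneg hnn] at hz
  have hlast := hz (n - 1) (Finset.mem_Ico.2 ⟨by omega, by omega⟩)
  have hnp : ∀ k ∈ Finset.range n, p k ≤ 0 := fun k hk =>
    (hp (by have := Finset.mem_range.1 hk; omega)).trans hlast.le
  rw [Finset.sum_eq_zero_iff_of_nonpos hnp] at hs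
  exact fun k hk => hs k (Finset.mem_range.2 hk)

theorem adjMatrix_H2n_mulVec_columnFun {n : ℕ} (p : ℕ → ℝ) {i a b c : ℕ} (hi : i < n)
    (ha : a < n) (hb : b < n) (hc : c < n) (hab : a ≠ b) (hac : a ≠ c) (hbc : b ≠ c)
    (h : ∀ j < n, H2nRel n (i + 1) (j + 1) ↔ j = a ∨ j = b ∨ j = c) :
    ((H2n n).adjMatrix ℝ).mulVec (columnFun n p) (Sum.inl ⟨i, hi⟩) = p a + p b + p c := by
  have h1 : ((H2n n).adjMatrix ℝ).mulVec (columnFun n p) (Sum.inl ⟨i, hi⟩) =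
      ∑ j ∈ Finset.range n, if H2nRel n (i + 1) (j + 1) then p j else 0 := by
    simp only [Matrix.mulVec, dotProduct, Fintype.sum_sum_type, SimpleGraph.adjMatrix_apply,
      H2n_not_adj_inl, H2n_adj_inl_inr, columnFun, Sum.elim_inr, Finset.sum_range, if_false,
      zero_mul, Finset.sum_const_zero, zero_add, ite_mul, one_mul]
  rw [h1, ← Finset.sum_filter]
  have h2 : (Finset.range n).filter (fun j => H2nRel n (i + 1) (j + 1)) = {a, b, c} := by
    ext j
    simp only [Finset.mem_filter, Finset.mem_range, Finset.mem_insert, Finset.mem_singleton]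
    constructor
    · exact fun ⟨h3, h4⟩ => (h j h3).1 h4
    · intro h3
      have h4 : j < n := by omega
      exact ⟨h4, (h j h4).2 h3⟩
  rw [h2, Finset.sum_insert (by simp [hab, hac]), Finset.sum_insert (by simp [hbc]),
    Finset.sum_singleton, add_assoc]

/-- A monotone eigenfunction of `H_{2n}` that is constant on the columns and on the two end blocks
is strictly increasing between the end blocks. -/
theorem columnFun_strictMono {m : ℕ} {p : ℕ → ℝ} (hp : Monotone p) (h0 : p 0 = p 1)
    (h1 : p (m + 5) = p (m + 4)) (hs : ∑ i ∈ Finset.range (m + 6), p i = 0)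
    (hne : ∃ i < m + 6, p i ≠ 0) {μ : ℝ} (hμ : 0 < μ)
    (he : ((H2n (m + 6)).adjMatrix ℝ).mulVec (columnFun (m + 6) p) =
      (3 - μ) • columnFun (m + 6) p) :
    ∀ i, 1 ≤ i → i < m + 4 → p i < p (i + 1) := by
  have heq : ∀ {i a b c : ℕ} (hi : i < m + 6), a < m + 6 → b < m + 6 → c < m + 6 → a ≠ b → a ≠ c →
      b ≠ c → (∀ j < m + 6, H2nRel (m + 6) (i + 1) (j + 1) ↔ j = a ∨ j = b ∨ j = c) →
      p a + p b + p c = (3 - μ) * p i := by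
    intro i a b c hi ha hb hc hab hac hbc h
    rw [← adjMatrix_H2n_mulVec_columnFun p hi ha hb hc hab hac hbc h, he]
    rfl
  have hneg : ∀ i, i + 1 < m + 6 → ∑ k ∈ Finset.range (i + 1), p k < 0 := by
    intro i hi
    by_contra hcon
    obtain ⟨k, hk, hk0⟩ := hne
    exact hk0 (eq_zero_of_sum_nonneg hp hs hi (not_lt.1 hcon) k hk)
  -- This is the eigenvalue equation summed over the columns up to `i + 2`: inner edges cancel and
  -- only the flow across the cut remains. By `hneg` the flow is positive.
  have hflow : ∀ i, i < m + 1 →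
      p (i + 3) - p (i + 2) = -μ * ∑ k ∈ Finset.range (i + 3), p k := by
    intro i
    induction i with
    | zero =>
      intro _
      have e0 := heq (i := 0) (a := 0) (b := 1) (c := 2) (by omega) (by omega) (by omega)
        (by omega) (by omega) (by omega) (by omega) (by intro j _; unfold H2nRel; omega)
      have e2 := heq (i := 2) (a := 0) (b := 1) (c := 3) (by omega) (by omega) (by omega)
        (by omega) (by omega) (by omega) (by omega) (by intro j _; unfold H2nRel; omega)
      have hm : μ * p 0 = μ * p 1 := by rw [h0]
      simp only [zero_add, Finset.sum_range_succ, Finset.sum_range_zero]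
      linarith
    | succ i ih =>
      intro hi
      have e := heq (i := i + 3) (a := i + 2) (b := i + 3) (c := i + 4) (by omega) (by omega)
        (by omega) (by omega) (by omega) (by omega) (by omega)
        (by intro j _; unfold H2nRel; omega)
      have e' := ih (by omega)
      rw [show i + 1 + 3 = i + 3 + 1 by ring, Finset.sum_range_succ, mul_add, ← e',
        show i + 3 + 1 = i + 4 by ring, show i + 1 + 2 = i + 3 by ring]
      linarith
  intro i hi1 hi
  rcases Nat.lt_or_ge i 2 with h2 | h2
  · obtain rfl : i = 1 := by omega
    have e0 := heq (i := 0) (a := 0) (b := 1) (c := 2) (by omega) (by omega) (by omega)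
      (by omega) (by omega) (by omega) (by omega) (by intro j _; unfold H2nRel; omega)
    have h3 := hneg 0 (by omega)
    simp only [zero_add, Finset.sum_range_one] at h3
    have := mul_neg_of_pos_of_neg hμ h3
    simp only [Nat.reduceAdd]
    linarith
  · rcases Nat.lt_or_ge i (m + 3) with h3 | h3
    · obtain ⟨k, rfl⟩ := Nat.exists_eq_add_of_le' h2
      have e := hflow k (by omega)
      have := mul_neg_of_pos_of_neg hμ (hneg (k + 2) (by omega))
      rw [show k + 2 + 1 = k + 3 by ring] at *
      linarith
    · obtain rfl : i = m + 3 := by omega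
      have e0 := heq (i := m + 5) (a := m + 3) (b := m + 4) (c := m + 5) (by omega) (by omega)
        (by omega) (by omega) (by omega) (by omega) (by omega)
        (by intro j _; unfold H2nRel; omega)
      have h4 := hneg (m + 4) (by omega)
      rw [show m + 4 + 1 = m + 5 by ring] at h4
      rw [Finset.sum_range_succ] at hs
      have := mul_pos hμ (show 0 < p (m + 5) by linarith)
      rw [show m + 3 + 1 = m + 4 by ring]
      linarith

theorem blockAverage_monotone (m : ℕ) {x : ℕ → ℝ} (hx : Monotone x) :
    Monotone (blockAverage m x) := by
  refine monotone_nat_of_le_succ fun i => ?_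
  have hle : ∀ i j, i ≤ j → x i ≤ x j := fun i j h => hx h
  rcases Nat.lt_or_ge i 1 with h1 | h1
  · obtain rfl : i = 0 := by omega
    rw [zero_add, blockAverage_zero, blockAverage_one]
  rcases Nat.lt_or_ge i 2 with h2 | h2
  · obtain rfl : i = 1 := by omega
    rw [blockAverage_one, show 1 + 1 = 0 + 2 by ring, blockAverage_mid x (by omega)]
    have := hle 0 (2 * 0 + 4) (by omega)
    have := hle 1 (2 * 0 + 4) (by omega)
    have := hle 2 (2 * 0 + 4) (by omega)
    have := hle 3 (2 * 0 + 4) (by omega)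
    have := hle (2 * 0 + 4) (2 * 0 + 5) (by omega)
    linarith
  rcases Nat.lt_or_ge i (m + 3) with h3 | h3
  · obtain ⟨k, rfl⟩ := Nat.exists_eq_add_of_le' h2
    rw [blockAverage_mid x (by omega), show k + 2 + 1 = k + 1 + 2 by ring,
      blockAverage_mid x (by omega)]
    have := hle (2 * k + 4) (2 * (k + 1) + 4) (by omega)
    have := hle (2 * k + 5) (2 * (k + 1) + 5) (by omega)
    linarith
  rcases Nat.lt_or_ge i (m + 4) with h4 | h4
  · obtain rfl : i = m + 3 := by omega
    rw [show m + 3 + 1 = m + 4 by ring, blockAverage_last, show m + 3 = m + 1 + 2 by ring,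
      blockAverage_mid x (by omega)]
    have := hle (2 * (m + 1) + 4) (2 * (m + 1) + 5) (by omega)
    have := hle (2 * (m + 1) + 5) (2 * m + 8) (by omega)
    have := hle (2 * (m + 1) + 5) (2 * m + 9) (by omega)
    have := hle (2 * (m + 1) + 5) (2 * m + 10) (by omega)
    have := hle (2 * (m + 1) + 5) (2 * m + 11) (by omega)
    linarith
  · unfold blockAverage
    rw [if_neg (by omega), if_pos (by omega), if_neg (by omega), if_pos (by omega)]

/-! ### The equality case: cut sizes -/

/-- If the order is constant on blocks, strictly increasing between them, and its energy is at most
that of `H_{2n}`, then the cuts between blocks have the same sizes as in `H_{2n}` and no edge joins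
blocks that are not consecutive. -/
theorem crossing_eq_of_energy_le {m : ℕ} {a : ℕ → ℕ → ℕ} {b : ℕ → Bool}
    (h : OrderedCubic (2 * m + 12) a b) {x : ℕ → ℝ} (hx : Monotone x)
    (hl : x 0 = x 3) (hr : x (2 * m + 8) = x (2 * m + 11))
    (hmid : ∀ j < m + 2, x (2 * j + 4) = x (2 * j + 5))
    (hpos : ∀ j < m + 3, x (2 * j + 3) < x (2 * j + 4))
    (hE : orderedEnergy (2 * m + 12) a x ≤
      dirichletEnergy (H2n (m + 6)) (columnFun (m + 6) (blockAverage m x))) :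
    crossing (2 * m + 12) a 3 3 = 4 ∧ crossing (2 * m + 12) a (2 * m + 7) (2 * m + 7) = 4 ∧
    (∀ j < m + 1, crossing (2 * m + 12) a (2 * j + 5) (2 * j + 5) = 2) ∧
    ∀ i j, i < j → j < m + 3 → crossing (2 * m + 12) a (2 * i + 3) (2 * j + 3) = 0 := by
  set d : ℕ → ℝ := fun k => x (k + 1) - x k with hd
  have hd0 : ∀ k, 0 ≤ d k := fun k => sub_nonneg.2 (hx (Nat.le_succ k))
  have hdp : ∀ j < m + 3, 0 < d (2 * j + 3) := fun j hj => sub_pos.2 (hpos j hj)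
  have hx01 : x 1 = x 0 := le_antisymm ((hx (by omega)).trans hl.ge) (hx (by omega))
  have hx02 : x 2 = x 0 := le_antisymm ((hx (by omega)).trans hl.ge) (hx (by omega))
  have hy1 : x (2 * m + 9) = x (2 * m + 8) :=
    le_antisymm ((hx (by omega)).trans hr.ge) (hx (by omega))
  have hy2 : x (2 * m + 10) = x (2 * m + 8) :=
    le_antisymm ((hx (by omega)).trans hr.ge) (hx (by omega))
  have hz0 : d 0 = 0 := sub_eq_zero.2 hx01
  have hz1 : d 1 = 0 := sub_eq_zero.2 (hx02.trans hx01.symm)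
  have hz2 : d 2 = 0 := sub_eq_zero.2 (hl.symm.trans hx02.symm)
  have hw0 : d (2 * m + 8) = 0 := sub_eq_zero.2 hy1
  have hw1 : d (2 * m + 9) = 0 := sub_eq_zero.2 (hy2.trans hy1.symm)
  have hw2 : d (2 * m + 10) = 0 := sub_eq_zero.2 (hr.symm.trans hy2.symm)
  have hzm : ∀ j < m + 2, d (2 * j + 4) = 0 := fun j hj => sub_eq_zero.2 (hmid j hj).symm
  set C : ℕ → ℕ → ℝ := fun k l => crossing (2 * m + 12) a k l with hC
  have hEH : dirichletEnergy (H2n (m + 6)) (columnFun (m + 6) (blockAverage m x)) =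
      4 * d 3 ^ 2 + 2 * ∑ j ∈ Finset.range (m + 1), d (2 * j + 5) ^ 2 + 4 * d (2 * m + 7) ^ 2 := by
    rw [dirichletEnergy_columnFun m _ (by rw [blockAverage_zero, blockAverage_one])
      (by rw [blockAverage_last, blockAverage_last'])]
    have e1 : blockAverage m x 2 - blockAverage m x 1 = d 3 := by
      rw [blockAverage_one, blockAverage_mid x (show 0 < m + 2 by omega), ← hmid 0 (by omega), hx01,
        hx02, hl]
      simp only [hd]; ring_nf
    have e2 : blockAverage m x (m + 4) - blockAverage m x (m + 3) = d (2 * m + 7) := by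
      rw [blockAverage_last, show m + 3 = m + 1 + 2 by ring,
        blockAverage_mid x (show m + 1 < m + 2 by omega), hmid (m + 1) (by omega), hy1, hy2, ← hr]
      simp only [hd]; ring_nf
    rw [e1, e2, Finset.sum_congr rfl fun j hj => ?_]
    have hj := Finset.mem_range.1 hj
    rw [show j + 3 = j + 1 + 2 by ring, blockAverage_mid x (show j + 1 < m + 2 by omega),
      blockAverage_mid x (show j < m + 2 by omega), hmid j (by omega), ← hmid (j + 1) (by omega)]
    simp only [hd]; ring_nf
  -- Increments inside blocks vanish, so only the cuts at the boundaries `3, 5, …, 2 * m + 7`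
  -- contribute.
  have hsum : ∑ k ∈ Finset.range (2 * m + 12 - 1), C k k * d k ^ 2 = C 3 3 * d 3 ^ 2 +
      ∑ j ∈ Finset.range (m + 1), C (2 * j + 5) (2 * j + 5) * d (2 * j + 5) ^ 2 +
        C (2 * m + 7) (2 * m + 7) * d (2 * m + 7) ^ 2 := by
    have : ∑ k ∈ Finset.range (2 * m + 12), C k k * d k ^ 2 =
        ∑ k ∈ Finset.range (2 * m + 12 - 1), C k k * d k ^ 2 := by
      rw [show 2 * m + 12 = 2 * m + 11 + 1 by ring, Finset.sum_range_succ,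
        show C (2 * m + 11) (2 * m + 11) = 0 by simp [hC, crossing]]
      simp
    rw [← this, sum_range_blocks m, Finset.sum_range_succ]
    rw [Finset.sum_congr rfl fun j hj => by rw [hzm j (by have := Finset.mem_range.1 hj; omega)],
      hz0, hz1, hz2, hw0, hw1, hw2, hzm (m + 1) (by omega), show 2 * (m + 1) + 5 = 2 * m + 7 by ring,
      show C (2 * m + 11) (2 * m + 11) = 0 by simp [hC, crossing]]
    simp [add_assoc]
  have k3 : (4 : ℝ) ≤ C 3 3 := by
    obtain ⟨-, -, -, -, -, -, -, -, -, h3⟩ := h.crossing_initial (by omega)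
    have : 4 ≤ crossing (2 * m + 12) a 3 3 := by omega
    exact Nat.ofNat_le_cast.2 this
  have k7 : (4 : ℝ) ≤ C (2 * m + 7) (2 * m + 7) := by
    obtain ⟨hr', hrc⟩ := h.reverse
    obtain ⟨-, -, -, -, -, -, -, -, -, h3⟩ := hr'.crossing_initial (by omega)
    rw [hrc 3 3 le_rfl (by omega), show 2 * m + 12 - 2 - 3 = 2 * m + 7 by omega] at h3
    have : 4 ≤ crossing (2 * m + 12) a (2 * m + 7) (2 * m + 7) := by omega
    exact Nat.ofNat_le_cast.2 this
  have k5 : ∀ j < m + 1, (2 : ℝ) ≤ C (2 * j + 5) (2 * j + 5) := fun j hj =>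
    Nat.ofNat_le_cast.2 (h.crossing_odd (by omega) (by omega)).1
  -- All summands are nonnegative, so each is zero; the increments being positive, the coefficients
  -- vanish. One off-diagonal pair at a time suffices.
  have hmain : ∀ i j, i < j → j < m + 3 → (C 3 3 - 4) * d 3 ^ 2 +
      ∑ j ∈ Finset.range (m + 1), (C (2 * j + 5) (2 * j + 5) - 2) * d (2 * j + 5) ^ 2 +
      (C (2 * m + 7) (2 * m + 7) - 4) * d (2 * m + 7) ^ 2 +
      2 * C (2 * i + 3) (2 * j + 3) * d (2 * i + 3) * d (2 * j + 3) ≤ 0 := by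
    intro i j hij hj
    have h1 := sum_crossing_add_le_orderedEnergy (N := 2 * m + 12) a hx
      (show 2 * i + 3 < 2 * j + 3 by omega) (by omega)
    change ∑ k ∈ Finset.range (2 * m + 12 - 1), C k k * d k ^ 2 +
      2 * C (2 * i + 3) (2 * j + 3) * d (2 * i + 3) * d (2 * j + 3) ≤ _ at h1
    rw [hsum] at h1
    rw [hEH, Finset.mul_sum] at hE
    simp only [sub_mul, Finset.sum_sub_distrib]
    linarith
  have p3 := mul_nonneg (sub_nonneg.2 k3) (sq_nonneg (d 3))
  have p7 := mul_nonneg (sub_nonneg.2 k7) (sq_nonneg (d (2 * m + 7)))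
  have p5 : ∀ j ∈ Finset.range (m + 1),
      0 ≤ (C (2 * j + 5) (2 * j + 5) - 2) * d (2 * j + 5) ^ 2 := fun j hj =>
    mul_nonneg (sub_nonneg.2 (k5 j (Finset.mem_range.1 hj))) (sq_nonneg _)
  have p5' := Finset.sum_nonneg p5
  have pc : ∀ i j, 0 ≤ 2 * C (2 * i + 3) (2 * j + 3) * d (2 * i + 3) * d (2 * j + 3) :=
    fun i j => mul_nonneg (mul_nonneg (mul_nonneg two_pos.le (Nat.cast_nonneg _)) (hd0 _)) (hd0 _)
  have h01 := hmain 0 1 one_pos (by omega)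
  have pc01 := pc 0 1
  have hcancel : ∀ {c q : ℝ} {j : ℕ}, j < m + 3 → (c - q) * d (2 * j + 3) ^ 2 = 0 → c = q := by
    intro c q j hj h0
    have := (hdp j hj).ne'
    have h2 := (mul_eq_zero.1 h0).resolve_right (pow_ne_zero 2 this)
    linarith
  refine ⟨?_, ?_, ?_, ?_⟩
  · have : C 3 3 = 4 := hcancel (j := 0) (by omega) (by rw [mul_zero, zero_add]; linarith)
    exact_mod_cast (show ((crossing _ a _ _ : ℕ) : ℝ) = _ from this)
  · have : C (2 * m + 7) (2 * m + 7) = 4 := hcancel (j := m + 2) (by omega) (by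
      rw [show 2 * (m + 2) + 3 = 2 * m + 7 by ring]; linarith)
    exact_mod_cast (show ((crossing _ a _ _ : ℕ) : ℝ) = _ from this)
  · intro j hj
    have hz : ∑ j ∈ Finset.range (m + 1), (C (2 * j + 5) (2 * j + 5) - 2) * d (2 * j + 5) ^ 2 = 0 := by
      linarith
    rw [Finset.sum_eq_zero_iff_of_nonneg p5] at hz
    have : C (2 * j + 5) (2 * j + 5) = 2 := hcancel (j := j + 1) (by omega) (by
      rw [show 2 * (j + 1) + 3 = 2 * j + 5 by ring]; exact hz j (Finset.mem_range.2 hj))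
    exact_mod_cast (show ((crossing _ a _ _ : ℕ) : ℝ) = _ from this)
  · intro i j hij hj
    have h1 := hmain i j hij hj
    have h2 : 2 * C (2 * i + 3) (2 * j + 3) * d (2 * i + 3) * d (2 * j + 3) = 0 := by
      linarith [pc i j]
    have h3 := (hdp i (by omega)).ne'
    have h4 := (hdp j hj).ne'
    have : C (2 * i + 3) (2 * j + 3) = 0 := by
      simpa [h3, h4] using h2
    exact_mod_cast (show ((crossing _ a _ _ : ℕ) : ℝ) = _ from this)

/-! ### The equality case: reconstructing `H_{2n}` -/

namespace OrderedCubic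

variable {N : ℕ} {a : ℕ → ℕ → ℕ} {b : ℕ → Bool}

theorem eq_zero_of_crossing {k l : ℕ} (hz : crossing N a k l = 0) {i j : ℕ} (hi : i ≤ k)
    (hj : l < j) (hjN : j < N) : a i j = 0 := by
  unfold crossing at hz
  rw [Finset.sum_eq_zero_iff] at hz
  have h1 := hz i (Finset.mem_range.2 (by omega))
  rw [Finset.sum_eq_zero_iff] at h1
  exact h1 j (Finset.mem_Ico.2 ⟨hj, hjN⟩)

/-- A row of the adjacency numbers that is supported on `{p, …, p + r - 1}` sums to `3` there. -/
theorem sum_support (h : OrderedCubic N a b) {i : ℕ} (hi : i < N) (p r : ℕ) (hpr : p + r ≤ N)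
    (hlow : ∀ j < p, a i j = 0) (hhigh : ∀ j, p + r ≤ j → j < N → a i j = 0) :
    ∑ j ∈ Finset.range r, a i (p + j) = 3 := by
  rw [← h.deg i hi, ← Finset.sum_range_add_sum_Ico _ hpr,
    Finset.sum_eq_zero (s := Finset.Ico (p + r) N) fun j hj =>
      hhigh j (Finset.mem_Ico.1 hj).1 (Finset.mem_Ico.1 hj).2, add_zero, Finset.sum_range_add,
    Finset.sum_eq_zero (s := Finset.range p) fun j hj => hlow j (Finset.mem_range.1 hj), zero_add]

theorem bool_eq_of_ne {b₁ b₂ b₃ : Bool} (h₁ : b₁ ≠ b₂) (h₂ : b₃ ≠ b₂) : b₁ = b₃ := by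
  revert h₁ h₂; cases b₁ <;> cases b₂ <;> cases b₃ <;> simp

/-- The shape of the graph at the beginning of the order. -/
theorem initial_block (h : OrderedCubic N a b) (hN : 8 ≤ N) (h3 : crossing N a 3 3 = 4)
    (h5 : crossing N a 5 5 = 2) (h35 : crossing N a 3 5 = 0) (h57 : crossing N a 5 7 = 0) :
    (∀ c, ∃ s r, s < 4 ∧ r < 4 ∧ s ≠ r ∧ b s = c ∧ b r = c) ∧
    (∀ i < 4, ∀ j < 4, b i ≠ b j → a i j = 1) ∧ b 4 ≠ b 5 ∧
    (∀ i < 4, b i ≠ b 4 → a i 4 = 1) ∧ (∀ i < 4, b i ≠ b 5 → a i 5 = 1) ∧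
    a 4 6 + a 4 7 = 1 ∧ a 5 6 + a 5 7 = 1 := by
  have c33 := h.crossing_add (k := 3) (l := 3) (by omega) (by omega)
  have c55 := h.crossing_add (k := 5) (l := 5) (by omega) (by omega)
  have r : ∀ i < 4, a i 0 + a i 1 + a i 2 + a i 3 + a i 4 + a i 5 = 3 := by
    intro i hi
    have := h.sum_support (i := i) (by omega) 0 6 (by omega) (by omega)
      fun j hj hjN => eq_zero_of_crossing h35 (show i ≤ 3 by omega) (by omega) hjN
    simpa only [Finset.sum_range_succ, Finset.sum_range_zero, zero_add] using this
  have r' : ∀ i < 6, a i 0 + a i 1 + a i 2 + a i 3 + a i 4 + a i 5 + a i 6 + a i 7 = 3 := by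
    intro i hi
    have := h.sum_support (i := i) (by omega) 0 8 (by omega) (by omega)
      fun j hj hjN => eq_zero_of_crossing h57 (show i ≤ 5 by omega) (by omega) hjN
    simpa only [Finset.sum_range_succ, Finset.sum_range_zero, zero_add] using this
  have r0 := r 0 (by omega)
  have r1 := r 1 (by omega)
  have r2 := r 2 (by omega)
  have r3 := r 3 (by omega)
  have r4 := r' 4 (by omega)
  have r5 := r' 5 (by omega)
  have e := h.color
  simp only [Finset.sum_range_succ, Finset.sum_range_zero, zero_add, h.symm 1 0, h.symm 2 0,
    h.symm 2 1, h.symm 3 0, h.symm 3 1, h.symm 3 2, e 0 0 rfl, e 1 1 rfl, e 2 2 rfl, e 3 3 rfl,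
    h.symm 4 0, h.symm 4 1, h.symm 4 2, h.symm 4 3, h.symm 5 0, h.symm 5 1, h.symm 5 2,
    h.symm 5 3, h.symm 5 4, e 4 4 rfl, e 5 5 rfl, h3, h5]
    at c33 c55 r0 r1 r2 r3 r4 r5
  have t012 := h.triangle_le 0 1 2
  have t013 := h.triangle_le 0 1 3
  have t023 := h.triangle_le 0 2 3
  have t123 := h.triangle_le 1 2 3
  have l01 := h.le_one 0 1
  have l02 := h.le_one 0 2
  have l03 := h.le_one 0 3
  have l12 := h.le_one 1 2
  have l13 := h.le_one 1 3
  have l23 := h.le_one 2 3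
  -- A cut of size 4 means four inner edges, so the first four vertices form a 4-cycle; `hcases`
  -- lists the three labelled possibilities.
  have q0 : a 0 1 + a 0 2 + a 0 3 = 2 := by clear * - c33 t012 t013 t023 t123; omega
  have q1 : a 0 1 + a 1 2 + a 1 3 = 2 := by clear * - c33 t012 t013 t023 t123; omega
  have q2 : a 0 2 + a 1 2 + a 2 3 = 2 := by clear * - c33 t012 t013 t023 t123; omega
  have q3 : a 0 3 + a 1 3 + a 2 3 = 2 := by clear * - c33 t012 t013 t023 t123; omega
  have hcases : (b 0 = b 1 ∧ b 2 = b 3 ∧ b 0 ≠ b 2 ∧ a 0 2 = 1 ∧ a 0 3 = 1 ∧ a 1 2 = 1 ∧ a 1 3 = 1) ∨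
      (b 0 = b 2 ∧ b 1 = b 3 ∧ b 0 ≠ b 1 ∧ a 0 1 = 1 ∧ a 0 3 = 1 ∧ a 1 2 = 1 ∧ a 2 3 = 1) ∨
      (b 0 = b 3 ∧ b 1 = b 2 ∧ b 0 ≠ b 1 ∧ a 0 1 = 1 ∧ a 0 2 = 1 ∧ a 1 3 = 1 ∧ a 2 3 = 1) := by
    have hnum : (a 0 2 = 1 ∧ a 0 3 = 1 ∧ a 1 2 = 1 ∧ a 1 3 = 1) ∨
        (a 0 1 = 1 ∧ a 0 3 = 1 ∧ a 1 2 = 1 ∧ a 2 3 = 1) ∨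
        (a 0 1 = 1 ∧ a 0 2 = 1 ∧ a 1 3 = 1 ∧ a 2 3 = 1) := by
      clear * - q0 q1 q2 q3 l01 l02 l03; omega
    have n : ∀ {i j}, a i j = 1 → b i ≠ b j := fun h1 h2 => by simp [e _ _ h2] at h1
    rcases hnum with ⟨h02, h03, h12, h13⟩ | ⟨h01, h03, h12, h23⟩ | ⟨h01, h02, h13, h23⟩
    · exact Or.inl ⟨bool_eq_of_ne (n h02) (n h12), bool_eq_of_ne (n h02).symm (n h03).symm, n h02,
        h02, h03, h12, h13⟩
    · exact Or.inr (Or.inl ⟨bool_eq_of_ne (n h01) (n h12).symm,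
        bool_eq_of_ne (n h01).symm (n h03).symm, n h01, h01, h03, h12, h23⟩)
    · exact Or.inr (Or.inr ⟨bool_eq_of_ne (n h01) (n h13).symm,
        bool_eq_of_ne (n h01).symm (n h02).symm, n h01, h01, h02, h13, h23⟩)
  have hpair : ∀ c, ∃ s r, s < 4 ∧ r < 4 ∧ s ≠ r ∧ b s = c ∧ b r = c := by
    intro c
    rcases hcases with ⟨h1, h2, h3, -⟩ | ⟨h1, h2, h3, -⟩ | ⟨h1, h2, h3, -⟩
    · by_cases hc : b 0 = c
      · exact ⟨0, 1, by omega, by omega, by omega, hc, h1 ▸ hc⟩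
      · have : b 2 = c := bool_eq_of_ne h3.symm (Ne.symm hc)
        exact ⟨2, 3, by omega, by omega, by omega, this, h2 ▸ this⟩
    · by_cases hc : b 0 = c
      · exact ⟨0, 2, by omega, by omega, by omega, hc, h1 ▸ hc⟩
      · have : b 1 = c := bool_eq_of_ne h3.symm (Ne.symm hc)
        exact ⟨1, 3, by omega, by omega, by omega, this, h2 ▸ this⟩
    · by_cases hc : b 0 = c
      · exact ⟨0, 3, by omega, by omega, by omega, hc, h1 ▸ hc⟩
      · have : b 1 = c := bool_eq_of_ne h3.symm (Ne.symm hc)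
        exact ⟨1, 2, by omega, by omega, by omega, this, h2 ▸ this⟩
  -- The third neighbour of each block vertex is 4 or 5, as no edge leads from the block past 5.
  have hone : ∀ i < 4, a i 4 + a i 5 = 1 := by
    intro i hi
    interval_cases i
    · clear * - r0 q0; omega
    · clear * - r1 q1; omega
    · clear * - r2 q2; omega
    · clear * - r3 q3; omega
  have hn45 : b 4 ≠ b 5 := by
    intro h45
    obtain ⟨s, -, hs, -, -, hbs, -⟩ := hpair (b 4)
    have h1 := hone s hs
    rw [e s 4 hbs, e s 5 (hbs.trans h45)] at h1
    omega
  have h4 : ∀ i < 4, b i ≠ b 4 → a i 4 = 1 := by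
    intro i hi hb
    have h1 := hone i hi
    rwa [e i 5 (bool_eq_of_ne hb hn45.symm)] at h1
  have h5' : ∀ i < 4, b i ≠ b 5 → a i 5 = 1 := by
    intro i hi hb
    have h1 := hone i hi
    rwa [e i 4 (bool_eq_of_ne hb hn45), zero_add] at h1
  have s4 : a 0 4 + a 1 4 + a 2 4 + a 3 4 = 2 := by
    have w : ∀ i < 4, b i = b 4 ∧ a i 4 = 0 ∨ b i ≠ b 4 ∧ a i 4 = 1 := fun i hi =>
      (em (b i = b 4)).imp (fun hb => ⟨hb, e i 4 hb⟩) fun hb => ⟨hb, h4 i hi hb⟩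
    have w0 := w 0 (by omega)
    have w1 := w 1 (by omega)
    have w2 := w 2 (by omega)
    have w3 := w 3 (by omega)
    clear * - w0 w1 w2 w3 hcases
    rcases hcases with ⟨e1, e2, e3, -⟩ | ⟨e1, e2, e3, -⟩ | ⟨e1, e2, e3, -⟩ <;>
      cases hb0 : b 0 <;> cases hb4 : b 4 <;> simp_all
  refine ⟨hpair, ?_, hn45, h4, h5', ?_, ?_⟩
  · intro i hi j hj hij
    have key : ∀ i j, i < j → j < 4 → b i ≠ b j → a i j = 1 := by
      intro i j hij hj hb
      have hi : i < 3 := by omega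
      clear * - hcases hij hj hi hb
      rcases hcases with ⟨e1, e2, e3, e4, e5, e6, e7⟩ | ⟨e1, e2, e3, e4, e5, e6, e7⟩ |
        ⟨e1, e2, e3, e4, e5, e6, e7⟩ <;> interval_cases j <;> interval_cases i <;>
        first | assumption | exact (hb ‹_›).elim
    rcases lt_trichotomy i j with h' | h' | h'
    · exact key i j h' hj hij
    · exact (hij (by rw [h'])).elim
    · rw [h.symm]; exact key j i h' hi hij.symm
  -- Vertices 4 and 5 each receive two edges from the block. Since two edges leave `{0, …, 5}`, the
  -- two are not adjacent and each has one further edge.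
  · have o0 := hone 0 (by omega)
    have o1 := hone 1 (by omega)
    have o2 := hone 2 (by omega)
    have o3 := hone 3 (by omega)
    clear * - o0 o1 o2 o3 s4 c55 r4 r5 q0 q1 q2 q3
    omega
  · have o0 := hone 0 (by omega)
    have o1 := hone 1 (by omega)
    have o2 := hone 2 (by omega)
    have o3 := hone 3 (by omega)
    clear * - o0 o1 o2 o3 s4 c55 r4 r5 q0 q1 q2 q3
    omega

/-- The colours decide which of the two vertices of a column is the neighbour of `i`. -/
theorem link (h : OrderedCubic N a b) {i p : ℕ} (hb : b p ≠ b (p + 1))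
    (hs : a i p + a i (p + 1) = 1) : (b i ≠ b p → a i p = 1) ∧ (b i ≠ b (p + 1) → a i (p + 1) = 1) := by
  constructor
  · intro hi
    rwa [h.color i (p + 1) (bool_eq_of_ne hi hb.symm), add_zero] at hs
  · intro hi
    rwa [h.color i p (bool_eq_of_ne hi hb), zero_add] at hs

/-- Two consecutive columns of the order, the first of which is attached to the second by one edge
from each of its two vertices. -/
theorem column_step (h : OrderedCubic N a b) {p : ℕ} (hp : 1 ≤ p) (hN : p + 6 ≤ N)
    (hb : b p ≠ b (p + 1)) (h0 : a p (p + 2) + a p (p + 3) = 1)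
    (h1 : a (p + 1) (p + 2) + a (p + 1) (p + 3) = 1) (hc : crossing N a (p + 3) (p + 3) = 2)
    (z1 : crossing N a (p - 1) (p + 1) = 0) (z2 : crossing N a (p + 1) (p + 3) = 0)
    (z3 : crossing N a (p + 3) (p + 5) = 0) :
    b (p + 2) ≠ b (p + 3) ∧ a (p + 2) (p + 3) = 1 ∧ a (p + 2) (p + 4) + a (p + 2) (p + 5) = 1 ∧
      a (p + 3) (p + 4) + a (p + 3) (p + 5) = 1 := by
  -- Otherwise the vertex among `p`, `p + 1` of that common colour would have no neighbour in the
  -- next column.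
  have hbb : b (p + 2) ≠ b (p + 3) := by
    intro h23
    by_cases h02 : b p = b (p + 2)
    · rw [h.color _ _ h02, h.color _ _ (h02.trans h23)] at h0
      omega
    · have h12 : b (p + 1) = b (p + 2) := bool_eq_of_ne hb.symm (Ne.symm h02)
      rw [h.color _ _ h12, h.color _ _ (h12.trans h23)] at h1
      omega
  have hrow : ∀ i, p + 2 ≤ i → i ≤ p + 3 → a i p + a i (p + 1) + a i (p + 2) + a i (p + 3) +
      a i (p + 4) + a i (p + 5) = 3 := by
    intro i hi hi'
    have := h.sum_support (i := i) (by omega) p 6 hN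
      (fun j hj => by
        rw [h.symm]; exact eq_zero_of_crossing z1 (by omega) (by omega) (by omega))
      fun j hj hjN => eq_zero_of_crossing z3 hi' (by omega) hjN
    simpa only [Finset.sum_range_succ, Finset.sum_range_zero, zero_add, add_zero] using this
  have hright : ∀ i ≤ p + 3, ∑ j ∈ Finset.Ico (p + 3 + 1) N, a i j = a i (p + 4) + a i (p + 5) := by
    intro i hi
    rw [← Finset.sum_Ico_consecutive _ (show p + 3 + 1 ≤ p + 6 by omega) hN,
      Finset.sum_eq_zero (s := Finset.Ico (p + 6) N) fun j hj =>
        eq_zero_of_crossing z3 hi (by have := Finset.mem_Ico.1 hj; omega) (Finset.mem_Ico.1 hj).2,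
      Finset.sum_Ico_eq_sum_range, show p + 6 - (p + 3 + 1) = 2 by omega, Finset.sum_range_succ,
      Finset.sum_range_one]
    rfl
  have hc' : crossing N a (p + 3) (p + 3) = crossing N a (p + 1) (p + 3) +
      (a (p + 2) (p + 4) + a (p + 2) (p + 5)) + (a (p + 3) (p + 4) + a (p + 3) (p + 5)) := by
    rw [← hright (p + 2) (by omega), ← hright (p + 3) le_rfl, crossing, crossing,
      Finset.sum_range_succ, Finset.sum_range_succ]
  have hl : ∀ j, j = p + 2 ∨ j = p + 3 → a p j + a (p + 1) j = 1 := by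
    intro j hj
    by_cases hpj : b p = b j
    · rw [h.color _ _ hpj, zero_add]
      have hne : b (p + 1) ≠ b j := fun h' => hb (hpj.trans h'.symm)
      rcases hj with rfl | rfl
      · exact (h.link hbb h1).1 hne
      · exact (h.link hbb h1).2 hne
    · rw [h.color (p + 1) j (bool_eq_of_ne hb.symm (Ne.symm hpj)), add_zero]
      rcases hj with rfl | rfl
      · exact (h.link hbb h0).1 hpj
      · exact (h.link hbb h0).2 hpj
  have r2 := hrow (p + 2) le_rfl (by omega)
  have r3 := hrow (p + 3) (by omega) le_rfl
  have l2 := hl (p + 2) (Or.inl rfl)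
  have l3 := hl (p + 3) (Or.inr rfl)
  have s1 := h.symm (p + 2) p
  have s2 := h.symm (p + 2) (p + 1)
  have s3 := h.symm (p + 3) p
  have s4 := h.symm (p + 3) (p + 1)
  have s5 := h.symm (p + 3) (p + 2)
  have d2 := h.color (p + 2) (p + 2) rfl
  have d3 := h.color (p + 3) (p + 3) rfl
  have l := h.le_one (p + 2) (p + 3)
  clear * - hbb r2 r3 l2 l3 s1 s2 s3 s4 s5 d2 d3 l hc' hc z2
  -- Each new vertex has one edge to the left, hence two others. Only two edges go right from the
  -- pair in all, so the two vertices are adjacent and send one edge each.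
  exact ⟨hbb, by omega, by omega, by omega⟩

/-- An ordered cubic graph whose cuts are those of `H_{2n}` contains a copy of `H_{2n}`. -/
theorem exists_columns {m : ℕ} (h : OrderedCubic (2 * m + 12) a b)
    (h3 : crossing (2 * m + 12) a 3 3 = 4)
    (h7 : crossing (2 * m + 12) a (2 * m + 7) (2 * m + 7) = 4)
    (h5 : ∀ j < m + 1, crossing (2 * m + 12) a (2 * j + 5) (2 * j + 5) = 2)
    (hz : ∀ i j, i < j → j < m + 3 → crossing (2 * m + 12) a (2 * i + 3) (2 * j + 3) = 0) :
    ∃ w : Bool → ℕ → ℕ, (∀ c, ∀ i < m + 6, w c i < 2 * m + 12 ∧ b (w c i) = c) ∧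
      (∀ c, ∀ i < m + 6, ∀ j < m + 6, w c i = w c j → i = j) ∧
      ∀ i < m + 6, ∀ j < m + 6, H2nRel (m + 6) (i + 1) (j + 1) →
        a (w true i) (w false j) = 1 := by
  obtain ⟨hpair, hblock, hb2, hl4, hl5, hr4, hr5⟩ := h.initial_block (by omega) h3
    (h5 0 (by omega)) (hz 0 1 (by omega) (by omega)) (hz 1 2 (by omega) (by omega))
  obtain ⟨hr, hrc⟩ := h.reverse
  obtain ⟨hpair', hblock', hb2', hl4', hl5', -, -⟩ := hr.initial_block (by omega)
    (by rw [hrc _ _ (by omega) (by omega)]; exact h7)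
    (by rw [hrc _ _ (by omega) (by omega)]; exact h5 m (by omega))
    (by rw [hrc _ _ (by omega) (by omega)]; exact hz (m + 1) (m + 2) (by omega) (by omega))
    (by rw [hrc _ _ (by omega) (by omega)]; exact hz m (m + 1) (by omega) (by omega))
  simp only [show 2 * m + 12 - 1 = 2 * m + 11 by omega,
    show 2 * m + 11 - 4 = 2 * m + 7 by omega, show 2 * m + 11 - 5 = 2 * m + 6 by omega]
    at hpair' hblock' hb2' hl4' hl5'
  -- The pair `2 * k + 4, 2 * k + 5` is column `k + 2`. Its rung is claimed only for `1 ≤ k`, since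
  -- column 2 (the index `i = 3` of `H_{2n}`) has none. The last pair is reached from the reversed
  -- order.
  have hcol : ∀ k ≤ m, b (2 * k + 4) ≠ b (2 * k + 5) ∧
      a (2 * k + 4) (2 * k + 6) + a (2 * k + 4) (2 * k + 7) = 1 ∧
      a (2 * k + 5) (2 * k + 6) + a (2 * k + 5) (2 * k + 7) = 1 ∧
      (1 ≤ k → a (2 * k + 4) (2 * k + 5) = 1) := by
    intro k
    induction k with
    | zero => exact fun _ => ⟨hb2, hr4, hr5, fun h => absurd h (by omega)⟩
    | succ k ih =>
      intro hk
      obtain ⟨e1, e2, e3, -⟩ := ih (by omega)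
      obtain ⟨f1, f2, f3, f4⟩ := h.column_step (p := 2 * k + 4) (by omega) (by omega) e1 e2 e3
        (h5 (k + 1) (by omega)) (hz k (k + 1) (by omega) (by omega))
        (hz (k + 1) (k + 2) (by omega) (by omega)) (hz (k + 2) (k + 3) (by omega) (by omega))
      exact ⟨f1, f3, f4, fun _ => f2⟩
  have hb : ∀ i, 2 ≤ i → i < m + 4 → b (2 * i) ≠ b (2 * i + 1) := by
    intro i h2 hi
    obtain ⟨k, rfl⟩ := Nat.exists_eq_add_of_le' h2
    rcases Nat.lt_or_ge k (m + 1) with hk | hk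
    · exact (hcol k (by omega)).1
    · obtain rfl : k = m + 1 := by omega
      exact hb2'.symm
  choose s r hs hr0 hsr hbs hbr using hpair
  choose s' r' hs' hr' hsr' hbs' hbr' using hpair'
  -- The vertex of colour `c` in column `i`; each end block has two vertices of each colour, which
  -- fill two columns.
  set w : Bool → ℕ → ℕ := fun c i => if i = 0 then s c else if i = 1 then r c else
    if i = m + 4 then 2 * m + 11 - s' c else if i = m + 5 then 2 * m + 11 - r' c else
    if b (2 * i) = c then 2 * i else 2 * i + 1 with hw
  have w0 : ∀ c, w c 0 = s c := fun c => by simp [hw]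
  have w1 : ∀ c, w c 1 = r c := fun c => by simp [hw]
  have w4 : ∀ c, w c (m + 4) = 2 * m + 11 - s' c := fun c => by simp [hw]
  have w5 : ∀ c, w c (m + 5) = 2 * m + 11 - r' c := fun c => by simp [hw]
  have wm : ∀ c i, 2 ≤ i → i < m + 4 → (w c i = 2 * i ∧ b (2 * i) = c) ∨
      (w c i = 2 * i + 1 ∧ b (2 * i + 1) = c) := by
    intro c i h2 hi
    simp only [hw]
    rw [if_neg (by omega), if_neg (by omega), if_neg (by omega), if_neg (by omega)]
    by_cases hc : b (2 * i) = c
    · exact Or.inl ⟨if_pos hc, hc⟩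
    · exact Or.inr ⟨if_neg hc, bool_eq_of_ne (hb i h2 hi).symm (Ne.symm hc)⟩
  have hcases : ∀ i < m + 6, i = 0 ∨ i = 1 ∨ (2 ≤ i ∧ i < m + 4) ∨ i = m + 4 ∨ i = m + 5 := by
    intro i hi; omega
  have wlow : ∀ c, ∀ i ≤ 1, w c i < 4 ∧ b (w c i) = c := by
    intro c i hi
    obtain rfl | rfl : i = 0 ∨ i = 1 := by omega
    · rw [w0]; exact ⟨hs c, hbs c⟩
    · rw [w1]; exact ⟨hr0 c, hbr c⟩
  have whigh : ∀ c i, m + 4 ≤ i → i < m + 6 →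
      ∃ q < 4, w c i = 2 * m + 11 - q ∧ b (2 * m + 11 - q) = c := by
    intro c i hi hi'
    obtain rfl | rfl : i = m + 4 ∨ i = m + 5 := by omega
    · exact ⟨s' c, hs' c, w4 c, hbs' c⟩
    · exact ⟨r' c, hr' c, w5 c, hbr' c⟩
  have wb : ∀ c, ∀ i < m + 6, w c i < 2 * m + 12 ∧ b (w c i) = c := by
    intro c i hi
    rcases Nat.lt_or_ge i 2 with h2 | h2
    · obtain ⟨e1, e2⟩ := wlow c i (by omega)
      exact ⟨by omega, e2⟩
    rcases Nat.lt_or_ge i (m + 4) with h4 | h4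
    · rcases wm c i h2 h4 with ⟨e1, e2⟩ | ⟨e1, e2⟩ <;> rw [e1] <;> exact ⟨by omega, e2⟩
    · obtain ⟨q, hq, e1, e2⟩ := whigh c i h4 hi
      rw [e1]; exact ⟨by omega, e2⟩
  refine ⟨w, wb, ?_, ?_⟩
  · intro c i hi j hj hij
    have g0 := w0 c
    have g1 := w1 c
    have g4 := w4 c
    have g5 := w5 c
    have k1 := hs c
    have k2 := hr0 c
    have k3 := hsr c
    have k1' := hs' c
    have k2' := hr' c
    have k3' := hsr' c
    have gm : ∀ i, 2 ≤ i → i < m + 4 → 2 * i ≤ w c i ∧ w c i ≤ 2 * i + 1 := by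
      intro i h2 h4
      rcases wm c i h2 h4 with ⟨e1, -⟩ | ⟨e1, -⟩ <;> omega
    have gi := gm i
    have gj := gm j
    clear * - hi hj hij g0 g1 g4 g5 k1 k2 k3 k1' k2' k3' gi gj hcases
    rcases hcases i hi with rfl | rfl | hi' | rfl | rfl <;>
      rcases hcases j hj with rfl | rfl | hj' | rfl | rfl <;> first | rfl | omega
  -- Stated for both colours `c`, so that the remaining edges follow by exchanging the two sides.
  · have key : ∀ c, ∀ i < m + 6, ∀ j < m + 6, (i ≤ 1 ∧ j ≤ 2) ∨ (2 ≤ i ∧ i ≤ m + 2 ∧ j = i + 1) ∨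
        (3 ≤ i ∧ i ≤ m + 2 ∧ j = i) ∨ (m + 3 ≤ i ∧ m + 4 ≤ j) → a (w c i) (w (!c) j) = 1 := by
      intro c i hi j hj hij
      have hne : b (w c i) ≠ b (w (!c) j) := by
        rw [(wb c i hi).2, (wb (!c) j hj).2]; cases c <;> simp
      rcases hij with ⟨hi1, hj2⟩ | ⟨hi2, him, rfl⟩ | ⟨hi3, him, rfl⟩ | ⟨hi3, hj4⟩
      · rcases Nat.lt_or_ge j 2 with hj1 | hj1
        · exact hblock _ (wlow c i hi1).1 _ (wlow _ j (by omega)).1 hne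
        · obtain rfl : j = 2 := by omega
          rcases wm (!c) 2 le_rfl (by omega) with ⟨e1, -⟩ | ⟨e1, -⟩ <;> rw [e1] at hne ⊢
          · exact hl4 _ (wlow c i hi1).1 hne
          · exact hl5 _ (wlow c i hi1).1 hne
      · obtain ⟨k, rfl⟩ := Nat.exists_eq_add_of_le' hi2
        obtain ⟨-, f2, f3, -⟩ := hcol k (by omega)
        have hb' := hb (k + 3) (by omega) (by omega)
        rcases wm c (k + 2) hi2 (by omega) with ⟨e1, -⟩ | ⟨e1, -⟩ <;>
          rcases wm (!c) (k + 2 + 1) (by omega) (by omega) with ⟨e2, -⟩ | ⟨e2, -⟩ <;>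
          rw [e1, e2] at hne ⊢
        · exact (h.link hb' f2).1 hne
        · exact (h.link hb' f2).2 hne
        · exact (h.link hb' f3).1 hne
        · exact (h.link hb' f3).2 hne
      · obtain ⟨k, rfl⟩ := Nat.exists_eq_add_of_le' (show 2 ≤ j by omega)
        obtain ⟨-, -, -, f⟩ := hcol k (by omega)
        have f := f (by omega)
        rcases wm c (k + 2) (by omega) (by omega) with ⟨e1, -⟩ | ⟨e1, -⟩ <;>
          rcases wm (!c) (k + 2) (by omega) (by omega) with ⟨e2, -⟩ | ⟨e2, -⟩ <;>
          rw [e1, e2] at hne ⊢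
        · exact (hne rfl).elim
        · exact f
        · rw [h.symm]; exact f
        · exact (hne rfl).elim
      · obtain ⟨q, hq, e1, -⟩ := whigh (!c) j hj4 hj
        rcases Nat.lt_or_ge i (m + 4) with hi4 | hi4
        · obtain rfl : i = m + 3 := by omega
          rcases wm c (m + 3) (by omega) (by omega) with ⟨e2, -⟩ | ⟨e2, -⟩ <;>
            rw [e1, e2] at hne ⊢ <;> rw [h.symm]
          · exact hl5' q hq hne.symm
          · exact hl4' q hq hne.symm
        · obtain ⟨q', hq', e2, -⟩ := whigh c i hi4 hi
          rw [e1, e2] at hne ⊢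
          exact hblock' q' hq' q hq hne
    intro i hi j hj hR
    have hij : ((i ≤ 1 ∧ j ≤ 2) ∨ (2 ≤ i ∧ i ≤ m + 2 ∧ j = i + 1) ∨
        (3 ≤ i ∧ i ≤ m + 2 ∧ j = i) ∨ (m + 3 ≤ i ∧ m + 4 ≤ j)) ∨
        ((j ≤ 1 ∧ i ≤ 2) ∨ (2 ≤ j ∧ j ≤ m + 2 ∧ i = j + 1) ∨
        (3 ≤ j ∧ j ≤ m + 2 ∧ i = j) ∨ (m + 3 ≤ j ∧ m + 4 ≤ i)) := by
      unfold H2nRel at hR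
      clear * - hi hj hR
      omega
    rcases hij with hij | hij
    · exact key true i hi j hj hij
    · rw [h.symm]; exact key false j hj i hi hij

end OrderedCubic

/-! ### Sorting the vertices, and isomorphisms -/

/-- The graph on `{0, …, N - 1}` obtained by listing the vertices in increasing order of `f`. -/
theorem exists_ordering {V : Type*} [Fintype V] [DecidableEq V] (G : SimpleGraph V)
    [DecidableRel G.Adj] {N : ℕ} (hN : 0 < N) (hcard : Fintype.card V = N) (hG : G.Connected)
    (hd : G.IsRegularOfDegree 3) (hbip : G.IsBipartite) (f : V → ℝ) :
    ∃ (e : Fin N ≃ V) (a : ℕ → ℕ → ℕ) (b : ℕ → Bool) (x : ℕ → ℝ), OrderedCubic N a b ∧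
      Monotone x ∧ (∀ i : Fin N, x i = f (e i)) ∧
      (∀ i j : Fin N, a i j = 1 → G.Adj (e i) (e j)) ∧
      dirichletEnergy G f = orderedEnergy N a x := by
  classical
  set e₀ : Fin N ≃ V := (Fintype.equivFinOfCardEq hcard).symm
  set e : Fin N ≃ V := (Tuple.sort (f ∘ e₀)).trans e₀ with he
  have hmono : Monotone (f ∘ e) := Tuple.monotone_sort (f ∘ e₀)
  obtain ⟨c⟩ := hbip
  -- Clamping the index makes `x` constant past `N - 1`, hence monotone on all of `ℕ`.
  set pt : ℕ → V := fun i => e ⟨min i (N - 1), by omega⟩ with hpt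
  have hpte : ∀ i : Fin N, pt i = e i := by
    intro i
    have h1 := i.2
    simp only [hpt]
    congr 1
    exact Fin.ext (min_eq_left (by omega))
  have hptinj : ∀ i < N, ∀ j < N, pt i = pt j → i = j := by
    intro i hi j hj hij
    have h1 := hpte ⟨i, hi⟩
    have h2 := hpte ⟨j, hj⟩
    have h3 := e.injective (h1.symm.trans (hij.trans h2))
    exact Fin.mk.inj_iff.1 h3
  have hptsurj : ∀ v, ∃ i < N, pt i = v := fun v =>
    ⟨e.symm v, (e.symm v).2, by rw [hpte]; simp⟩
  have hsum : ∀ {M : Type} [AddCommMonoid M] (g : V → M),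
      ∑ v, g v = ∑ i ∈ Finset.range N, g (pt i) := by
    intro M _ g
    rw [Finset.sum_range, ← Equiv.sum_comp e]
    exact Finset.sum_congr rfl fun i _ => by rw [hpte]
  set a : ℕ → ℕ → ℕ := fun i j => if i < N ∧ j < N ∧ G.Adj (pt i) (pt j) then 1 else 0 with ha
  set x : ℕ → ℝ := fun i => f (pt i) with hx
  have haeq : ∀ i < N, ∀ j < N, a i j = if G.Adj (pt i) (pt j) then 1 else 0 := by
    intro i hi j hj
    simp [ha, hi, hj]
  refine ⟨e, a, fun i => decide (c (pt i) = 0), x, ⟨?_, ?_, ?_, ?_, ?_⟩, ?_, ?_, ?_, ?_⟩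
  · intro i j
    simp only [ha]; split_ifs <;> simp
  · intro i j
    simp only [ha, G.adj_comm (pt i)]
    congr 1
    exact propext ⟨fun h => ⟨h.2.1, h.1, h.2.2⟩, fun h => ⟨h.2.1, h.1, h.2.2⟩⟩
  · intro i j hij
    simp only [ha]
    refine if_neg fun h => c.valid h.2.2 ?_
    rw [decide_eq_decide] at hij
    omega
  · intro i hi
    rw [← hd (pt i), ← SimpleGraph.card_neighborFinset_eq_degree,
      Finset.sum_congr rfl fun j hj => haeq i hi j (Finset.mem_range.1 hj),
      ← hsum (fun v => if G.Adj (pt i) v then 1 else 0), ← Finset.card_filter]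
    congr 1
    ext v
    simp
  · intro k hk
    -- A walk from the first vertex to vertex `k + 1` must leave the initial segment.
    obtain ⟨p⟩ := hG.preconnected (pt 0) (pt (k + 1))
    obtain ⟨d, -, hd1, hd2⟩ := p.exists_boundary_dart {v | ∃ i ≤ k, pt i = v} ⟨0, by omega, rfl⟩
      (by
        rintro ⟨i, hi, hik⟩
        have := hptinj i (by omega) (k + 1) hk hik
        omega)
    obtain ⟨i, hi, hi'⟩ := hd1
    obtain ⟨j, hj, hj'⟩ := hptsurj d.snd
    have hkj : k < j := by
      by_contra hcon
      exact hd2 ⟨j, by omega, hj'⟩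
    have h1 : a i j = 1 := by
      rw [haeq i (by omega) j hj, hi', hj', if_pos d.adj]
    by_contra hcon
    have := OrderedCubic.eq_zero_of_crossing (Nat.eq_zero_of_not_pos hcon) hi hkj hj
    omega
  · intro i j hij
    exact hmono (Fin.mk_le_mk.2 (min_le_min_right _ hij))
  · exact fun i => congrArg f (hpte i)
  · intro i j hij
    rw [haeq i i.2 j j.2, hpte, hpte] at hij
    by_contra hcon
    simp [hcon] at hij
  · set F : ℕ → ℕ → ℝ := fun i j => a i j * (x j - x i) ^ 2 with hF
    have hE : ∑ u, ∑ v, (if G.Adj u v then (f u - f v) ^ 2 else 0) =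
        ∑ i ∈ Finset.range N, ∑ j ∈ Finset.range N, F i j := by
      rw [hsum]
      refine Finset.sum_congr rfl fun i hi => ?_
      rw [hsum]
      refine Finset.sum_congr rfl fun j hj => ?_
      simp only [hF]
      rw [haeq i (Finset.mem_range.1 hi) j (Finset.mem_range.1 hj)]
      split_ifs
      · simp only [hx]; push_cast; ring
      · simp
    have hsplit : ∀ i ∈ Finset.range N, ∑ j ∈ Finset.range N, F i j =
        ∑ j ∈ Finset.range i, F i j + ∑ j ∈ Finset.Ico (i + 1) N, F i j := by
      intro i hi
      rw [← Finset.sum_range_add_sum_Ico _ (show i + 1 ≤ N from Finset.mem_range.1 hi),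
        Finset.sum_range_succ, show F i i = 0 by simp [hF], add_zero]
    have hswap : ∑ i ∈ Finset.range N, ∑ j ∈ Finset.range i, F i j =
        ∑ i ∈ Finset.range N, ∑ j ∈ Finset.Ico (i + 1) N, F i j := by
      rw [Finset.sum_comm' (s' := fun j => Finset.Ico (j + 1) N) (t' := Finset.range N)
        (by intro i j; simp only [Finset.mem_range, Finset.mem_Ico]; omega)]
      refine Finset.sum_congr rfl fun i _ => Finset.sum_congr rfl fun j _ => ?_
      have : a j i = a i j := by
        simp only [ha, G.adj_comm (pt i)]
        congr 1
        exact propext ⟨fun h => ⟨h.2.1, h.1, h.2.2⟩, fun h => ⟨h.2.1, h.1, h.2.2⟩⟩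
      simp only [hF]
      rw [this]; ring
    rw [dirichletEnergy, hE, Finset.sum_congr rfl hsplit, Finset.sum_add_distrib, hswap]
    simp only [orderedEnergy, hF]
    ring

/-- A bijective homomorphism between finite regular graphs of the same degree is an isomorphism. -/
theorem nonempty_iso_of_bijective {V W : Type*} [Fintype V] [Fintype W] [DecidableEq W]
    {G : SimpleGraph V} {H : SimpleGraph W} [DecidableRel G.Adj] [DecidableRel H.Adj] {d : ℕ}
    (hG : G.IsRegularOfDegree d) (hH : H.IsRegularOfDegree d) {φ : V → W}
    (hφ : Function.Bijective φ) (hadj : ∀ u v, G.Adj u v → H.Adj (φ u) (φ v)) :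
    Nonempty (H ≃g G) := by
  refine ⟨RelIso.symm ⟨Equiv.ofBijective φ hφ, ?_⟩⟩
  intro u v
  refine ⟨fun h => ?_, hadj u v⟩
  -- Both sides have `d` elements, so the inclusion is an equality and adjacency is reflected.
  have hsub : (G.neighborFinset u).image φ ⊆ H.neighborFinset (φ u) := by
    intro w hw
    obtain ⟨v, hv, rfl⟩ := Finset.mem_image.1 hw
    rw [SimpleGraph.mem_neighborFinset] at hv ⊢
    exact hadj u v hv
  have heq := Finset.eq_of_subset_of_card_le hsub (by
    rw [Finset.card_image_of_injective _ hφ.1, SimpleGraph.card_neighborFinset_eq_degree,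
      SimpleGraph.card_neighborFinset_eq_degree, hG u, hH (φ u)])
  have hv : φ v ∈ H.neighborFinset (φ u) := (SimpleGraph.mem_neighborFinset _ _ _).2 h
  rw [← heq] at hv
  obtain ⟨v', hv', he⟩ := Finset.mem_image.1 hv
  rw [← hφ.1 he]
  exact (SimpleGraph.mem_neighborFinset _ _ _).1 hv'

theorem spectralGap_le_of_iso {V W : Type*} [Fintype V] [Fintype W] [DecidableEq V]
    [DecidableEq W] {G : SimpleGraph V} {H : SimpleGraph W} [DecidableRel G.Adj]
    [DecidableRel H.Adj] {d : ℕ} (hG : G.Connected) (hGd : G.IsRegularOfDegree d)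
    (hGc : 2 ≤ Fintype.card V) (hH : H.Connected) (hHd : H.IsRegularOfDegree d)
    (hHc : 2 ≤ Fintype.card W) (φ : G ≃g H) : spectralGap G ≤ spectralGap H := by
  obtain ⟨x, h1, h2, h3⟩ := (spectralGap_variational hH hHd hHc).1
  have h := ((spectralGap_variational hG hGd hGc).2 (x ∘ φ)
    ((Equiv.sum_comp φ.toEquiv x).trans h1)).1
  have h4 : ∑ v, (x ∘ φ) v ^ 2 = 1 := (Equiv.sum_comp φ.toEquiv fun w => x w ^ 2).trans h2
  have h5 : dirichletEnergy G (x ∘ φ) = dirichletEnergy H x := by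
    unfold dirichletEnergy
    congr 1
    rw [← Equiv.sum_comp φ.toEquiv]
    refine Finset.sum_congr rfl fun u _ => ?_
    rw [← Equiv.sum_comp φ.toEquiv]
    refine Finset.sum_congr rfl fun v _ => ?_
    exact if_congr φ.map_adj_iff.symm rfl rfl
  rw [h4, h5, h3, mul_one] at h
  exact h

/-! ### Minimality and uniqueness -/

-- The hypothesis is the inequality opposite to minimality; since it already forces equality of
-- gaps, this one statement gives both minimality and uniqueness.
set_option maxHeartbeats 600000 in
theorem iso_of_spectralGap_le {V : Type*} [Fintype V] [DecidableEq V] (G : SimpleGraph V)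
    [DecidableRel G.Adj] (m : ℕ) (hcard : Fintype.card V = 2 * m + 12) (hG : G.Connected)
    (hd : G.IsRegularOfDegree 3) (hbip : G.IsBipartite)
    (hle : spectralGap G ≤ spectralGap (H2n (m + 6))) :
    spectralGap G = spectralGap (H2n (m + 6)) ∧ Nonempty (G ≃g H2n (m + 6)) := by
  obtain ⟨f, hf0, hf1, hfE⟩ := (spectralGap_variational hG hd (by omega)).1
  obtain ⟨e, a, b, x, h, hx, hxf, hadj, hE⟩ :=
    exists_ordering G (by omega) hcard hG hd hbip f
  have hHc : (H2n (m + 6)).Connected := H2n_connected (by omega)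
  have hHd : (H2n (m + 6)).IsRegularOfDegree 3 := H2n_isRegularOfDegree (by omega)
  have hHcard : 2 ≤ Fintype.card (Fin (m + 6) ⊕ Fin (m + 6)) := by simp; omega
  set y := columnFun (m + 6) (blockAverage m x) with hy
  set μ := spectralGap (H2n (m + 6)) with hμ
  have hsum : ∀ φ : ℝ → ℝ, ∑ i ∈ Finset.range (2 * m + 12), φ (x i) = ∑ v, φ (f v) := by
    intro φ
    rw [Finset.sum_range, ← Equiv.sum_comp e]
    exact Finset.sum_congr rfl fun i _ => by rw [hxf]
  have hx0 : ∑ i ∈ Finset.range (2 * m + 12), x i = 0 := (hsum id).trans hf0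
  have hx1 : ∑ i ∈ Finset.range (2 * m + 12), x i ^ 2 = 1 := (hsum (· ^ 2)).trans hf1
  have hy0 : ∑ v, y v = 0 := (sum_columnFun_blockAverage m x).trans hx0
  have hkey := energy_blockAverage_le h hx
  have hdev := sum_sq_sub_sum_sq_blockAverage m x
  rw [hx1] at hkey hdev
  rw [← hE, hfE] at hkey
  obtain ⟨hvar, heig⟩ := (spectralGap_variational hHc hHd hHcard).2 y hy0
  have hhalf := spectralGap_H2n_le m
  have hμ0 : 0 < μ := spectralGap_pos hHc hHd hHcard
  have hnn : ∀ j ∈ Finset.range (m + 2), 0 ≤ (x (2 * j + 5) - x (2 * j + 4)) ^ 2 / 2 :=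
    fun j _ => by positivity
  have hnn' := Finset.sum_nonneg hnn
  have q1 := sq_nonneg (x 3 - x 0)
  have q2 := sq_nonneg (x (2 * m + 11) - x (2 * m + 8))
  have z0 : ((x 1 - x 0) ^ 2 + (x 2 - x 0) ^ 2 + (x 3 - x 0) ^ 2 + (x 2 - x 1) ^ 2 +
      (x 3 - x 1) ^ 2 + (x 3 - x 2) ^ 2) / 4 ≥ (x 3 - x 0) ^ 2 / 4 := by
    linarith [sq_nonneg (x 1 - x 0), sq_nonneg (x 2 - x 0), sq_nonneg (x 2 - x 1),
      sq_nonneg (x 3 - x 1), sq_nonneg (x 3 - x 2)]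
  have z1 : ((x (2 * m + 9) - x (2 * m + 8)) ^ 2 + (x (2 * m + 10) - x (2 * m + 8)) ^ 2 +
      (x (2 * m + 11) - x (2 * m + 8)) ^ 2 + (x (2 * m + 10) - x (2 * m + 9)) ^ 2 +
      (x (2 * m + 11) - x (2 * m + 9)) ^ 2 + (x (2 * m + 11) - x (2 * m + 10)) ^ 2) / 4 ≥
      (x (2 * m + 11) - x (2 * m + 8)) ^ 2 / 4 := by
    linarith [sq_nonneg (x (2 * m + 9) - x (2 * m + 8)), sq_nonneg (x (2 * m + 10) - x (2 * m + 8)),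
      sq_nonneg (x (2 * m + 10) - x (2 * m + 9)), sq_nonneg (x (2 * m + 11) - x (2 * m + 9)),
      sq_nonneg (x (2 * m + 11) - x (2 * m + 10))]
  have hdev0 : 0 ≤ 1 - ∑ v, y v ^ 2 := by linarith
  -- Any loss of norm in averaging would cost `3/5` per unit of energy while lowering the bound `μ
  -- |y|²` by at most `1/2` per unit.
  have hS : ∑ v, y v ^ 2 = 1 := by
    by_contra hne
    have h1 : 0 < 1 - ∑ v, y v ^ 2 := lt_of_le_of_ne hdev0 fun h => hne (by linarith)
    have h2 : μ * (1 - ∑ v, y v ^ 2) ≤ 1 / 2 * (1 - ∑ v, y v ^ 2) :=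
      mul_le_mul_of_nonneg_right hhalf hdev0
    linarith
  rw [hS] at hkey hdev hvar heig
  have hgap : spectralGap G = μ := le_antisymm hle (by linarith)
  refine ⟨hgap, ?_⟩
  have hEy : dirichletEnergy (H2n (m + 6)) y = μ := by linarith
  have hl : x 0 = x 3 := by
    have : (x 3 - x 0) ^ 2 = 0 := by linarith
    linarith [pow_eq_zero_iff (two_ne_zero) |>.1 this]
  have hr : x (2 * m + 8) = x (2 * m + 11) := by
    have : (x (2 * m + 11) - x (2 * m + 8)) ^ 2 = 0 := by linarith
    linarith [pow_eq_zero_iff (two_ne_zero) |>.1 this]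
  have hmid : ∀ j < m + 2, x (2 * j + 4) = x (2 * j + 5) := by
    have hz : ∑ j ∈ Finset.range (m + 2), (x (2 * j + 5) - x (2 * j + 4)) ^ 2 / 2 = 0 := by
      linarith
    rw [Finset.sum_eq_zero_iff_of_nonneg hnn] at hz
    intro j hj
    have h1 := hz j (Finset.mem_range.2 hj)
    have : (x (2 * j + 5) - x (2 * j + 4)) ^ 2 = 0 := by linarith
    linarith [pow_eq_zero_iff (two_ne_zero) |>.1 this]
  have hp : ∀ i, 1 ≤ i → i < m + 4 → blockAverage m x i < blockAverage m x (i + 1) := by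
    refine columnFun_strictMono (blockAverage_monotone m hx)
      (by rw [blockAverage_zero, blockAverage_one]) (by rw [blockAverage_last, blockAverage_last'])
      ?_ ?_ hμ0 (by simpa using heig (by rw [hEy, mul_one]))
    · rw [hy, sum_columnFun] at hy0
      linarith
    · by_contra hcon
      push Not at hcon
      rw [hy, sum_columnFun_sq, Finset.sum_eq_zero fun i hi => by
        rw [hcon i (Finset.mem_range.1 hi)]; norm_num] at hS
      norm_num at hS
  have hx01 : x 1 = x 0 := le_antisymm ((hx (by omega)).trans hl.ge) (hx (by omega))
  have hx02 : x 2 = x 0 := le_antisymm ((hx (by omega)).trans hl.ge) (hx (by omega))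
  have hy1 : x (2 * m + 9) = x (2 * m + 8) :=
    le_antisymm ((hx (by omega)).trans hr.ge) (hx (by omega))
  have hy2 : x (2 * m + 10) = x (2 * m + 8) :=
    le_antisymm ((hx (by omega)).trans hr.ge) (hx (by omega))
  have hpos : ∀ j < m + 3, x (2 * j + 3) < x (2 * j + 4) := by
    intro j hj
    have h1 := hp (j + 1) (by omega) (by omega)
    rcases Nat.eq_zero_or_pos j with rfl | hj0
    · rw [zero_add, blockAverage_one, show 1 + 1 = 0 + 2 by ring, blockAverage_mid x (by omega),
        ← hmid 0 (by omega), hx01, hx02, ← hl] at h1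
      simp only [mul_zero, zero_add] at h1 ⊢
      linarith
    obtain ⟨k, rfl⟩ := Nat.exists_eq_add_of_le' hj0
    rw [show k + 1 + 1 = k + 2 by ring, blockAverage_mid x (by omega), hmid k (by omega)] at h1
    rw [show 2 * (k + 1) + 3 = 2 * k + 5 by ring]
    rcases Nat.lt_or_ge k (m + 1) with hk | hk
    · rw [show k + 2 + 1 = k + 1 + 2 by ring, blockAverage_mid x (by omega),
        ← hmid (k + 1) (by omega)] at h1
      linarith
    · obtain rfl : k = m + 1 := by omega
      rw [show m + 1 + 2 + 1 = m + 4 by ring, blockAverage_last, hy1, hy2, ← hr] at h1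
      rw [show 2 * (m + 1 + 1) + 4 = 2 * m + 8 by ring]
      linarith
  obtain ⟨c3, c7, c5, cz⟩ := crossing_eq_of_energy_le h hx hl hr hmid hpos
    (by rw [← hE, hfE, hgap, ← hy, hEy])
  obtain ⟨w, hw1, hw2, hw3⟩ := h.exists_columns c3 c7 c5 cz
  set φ : Fin (m + 6) ⊕ Fin (m + 6) → V :=
    Sum.elim (fun i => e ⟨w true i, (hw1 true i i.2).1⟩) (fun i => e ⟨w false i, (hw1 false i i.2).1⟩)
    with hφ
  have hinj : Function.Injective φ := by
    have hne : ∀ i j : Fin (m + 6), w true i ≠ w false j := by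
      intro i j hij
      have h1 := (hw1 true i i.2).2
      rw [hij, (hw1 false j j.2).2] at h1
      exact Bool.false_ne_true h1
    rintro (i | i) (j | j) hij
    · have := Fin.mk.inj_iff.1 (e.injective hij)
      exact congrArg Sum.inl (Fin.ext (hw2 true i i.2 j j.2 this))
    · exact (hne i j (Fin.mk.inj_iff.1 (e.injective hij))).elim
    · exact (hne j i (Fin.mk.inj_iff.1 (e.injective hij)).symm).elim
    · have := Fin.mk.inj_iff.1 (e.injective hij)
      exact congrArg Sum.inr (Fin.ext (hw2 false i i.2 j j.2 this))
  have hbij : Function.Bijective φ := by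
    rw [Fintype.bijective_iff_injective_and_card]
    refine ⟨hinj, ?_⟩
    rw [hcard]; simp; omega
  refine nonempty_iso_of_bijective hHd hd hbij ?_
  rintro (i | i) (j | j) hij
  · exact (H2n_not_adj_inl i j hij).elim
  · exact hadj _ _ (hw3 i i.2 j j.2 hij)
  · exact (hadj _ _ (hw3 j j.2 i i.2 hij)).symm
  · exact (H2n_not_adj_inr i j hij).elim

theorem mainTheorem6 (n : ℕ) (hn : 6 ≤ n) :
    (Fintype.card (Fin n ⊕ Fin n) = 2 * n ∧ (H2n n).Connected ∧
      (H2n n).IsRegularOfDegree 3 ∧ (H2n n).IsBipartite) ∧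
    ∀ {V : Type*} [Fintype V] [DecidableEq V] (G : SimpleGraph V) [DecidableRel G.Adj],
      Fintype.card V = 2 * n → G.Connected → G.IsRegularOfDegree 3 → G.IsBipartite →
        spectralGap (H2n n) ≤ spectralGap G ∧
          (spectralGap G = spectralGap (H2n n) ↔ Nonempty (G ≃g H2n n)) := by
  have hcardH : Fintype.card (Fin n ⊕ Fin n) = 2 * n := by simp; omega
  refine ⟨⟨hcardH, H2n_connected hn, H2n_isRegularOfDegree hn, H2n_isBipartite n⟩, ?_⟩
  intro V _ _ G _ hcard hG hd hbip
  obtain ⟨m, rfl⟩ := Nat.exists_eq_add_of_le' hn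
  have hiso := iso_of_spectralGap_le G m (by omega) hG hd hbip
  refine ⟨?_, fun h => (hiso h.le).2, ?_⟩
  · by_contra hlt
    exact hlt (hiso (not_le.1 hlt).le).1.ge
  · rintro ⟨φ⟩
    exact (hiso (spectralGap_le_of_iso hG hd (by omega) (H2n_connected hn)
      (H2n_isRegularOfDegree hn) (by omega) φ)).1
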